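/- **Theorem (Weighted Alpert Bases).** Let $\mathbb K=\mathbb R$ or $\mathbb C$, let $\mu$ be a locally finite positive Borel measure on $\mathbb R^n$, let $\mathcal P$ be a finite-dimensional $\mathbb K$-linear space of $\mathbb K$-valued functions in $L^2_{\mathrm{loc}}(\mu)$ that contains the constant function $\mathbf 1$, and let $\mathcal D$ be a dyadic grid in $\mathbb R^n$: a collection of half-open cubes $\prod_i[a_i,a_i+2^k)$, $k\in\mathbb Z$, such that for each $k$ the cubes of side length $2^k$ in $\mathcal D$ partition $\mathbb R^n$, and the $2^n$ dyadic children of each cube of $\mathcal D$ belong to $\mathcal D$. Write $\mathfrak C(Q)$ for the set of children of $Q$, and $\ell(Q)$ for its side length. A *tower* is a sequence $I_1\subset I_2\subset\cdots$ of cubes of $\mathcal D$ with $\ell(I_m)=2^m$, and its *top* is $\bigcup_m I_m$. For a set $S$ that is a cube of $\mathcal D$ or a top, let $\mathbb E_{S;\mathcal P}^{\mu}$ be the orthogonal projection of $L^2(\mu)$ onto the finite-dimensional space $\{\mathbf 1_S\varphi:\varphi\in\mathcal P,\ \mathbf 1_S\varphi\in L^2(\mu)\}$. For $Q\in\mathcal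 D$ let $\bigtriangleup_{Q;\mathcal P}^{\mu}$ be the orthogonal projection of $L^2(\mu)$ onto the finite-dimensional space $$L^2_{Q;\mathcal P}(\mu)=\Big\{f=\sum_{Q'\in\mathfrak C(Q)}\mathbf 1_{Q'}\,p_{Q'}:\ p_{Q'}\in\mathcal P,\ \int_Q f\,\overline{\varphi}\,d\mu=0\ \text{ for all }\varphi\in\mathcal P\Big\}.$$ 1. There are finitely many distinct tops $\mathcal T_1,\dots,\mathcal T_T$, with $1\le T\le 2^n$, and $\{\mathbb E^\mu_{\mathcal T_t;\mathcal P}\}_{t=1}^T\cup\{\bigtriangleup^\mu_{Q;\mathcal P}\}_{Q\in\mathcal D}$ is a complete set of mutually orthogonal projections in $L^2(\mu)$: for all $f,g\in L^2(\mu)$, $$\langle \mathbb E^\mu_{\mathcal T_s;\mathcal P}f,\mathbb E^\mu_{\mathcal T_t;\mathcal P}g\rangle=0\ (s\ne t),\qquad \langle \mathbb E^\mu_{\mathcal T_t;\mathcal P}f,\bigtriangleup^\mu_{Q;\mathcal P}g\rangle=0,\qquad \langle \bigtriangleup^\mu_{P;\mathcal P}f,\bigtriangleup^\mu_{Q;\mathcal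 P}g\rangle=0\ (P\neq Q),$$ $$f=\sum_{t=1}^T\mathbb E^\mu_{\mathcal T_t;\mathcal P}f+\sum_{Q\in\mathcal D}\bigtriangleup^\mu_{Q;\mathcal P}f .$$ The series over $\mathcal D$ converges unconditionally in $L^2(\mu)$. It also converges pointwise $\mu$-almost everywhere, in the following sense: for $\mu$-a.e. $x$, $\bigtriangleup^\mu_{Q;\mathcal P}f(x)=0$ for every $Q\in\mathcal D$ not containing $x$, and $$\sum_{t=1}^T\mathbb E^\mu_{\mathcal T_t;\mathcal P}f(x)+\sum_{Q\in\mathcal D:\ x\in Q,\ 2^a\le\ell(Q)\le2^b}\bigtriangleup^\mu_{Q;\mathcal P}f(x)\ \longrightarrow\ f(x)$$ as $a\to-\infty$ and $b\to+\infty$ independently. 2. For $P,Q\in\mathcal D$ with $Q\subsetneq P$, there are finitely many $I\in\mathcal D$ with $Q\subsetneq I\subset P$, and for every $f\in L^2(\mu)$, $\mu$-almost everywhere, $$\mathbf 1_Q\sum_{I\in\mathcal D:\ Q\subsetneq I\subset P}\bigtriangleup^\mu_{I;\mathcal P}f=\mathbb E^\mu_{Q;\mathcal P}f-\mathbf 1_Q\,\mathbb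 E^\mu_{P;\mathcal P}f .$$ 3. For all $Q\in\mathcal D$, $\varphi\in\mathcal P$ and $f\in L^2(\mu)$, the function $\bigtriangleup^\mu_{Q;\mathcal P}f\;\overline\varphi$ is $\mu$-integrable and $$\int_{\mathbb R^n}\bigtriangleup^\mu_{Q;\mathcal P}f(x)\,\overline{\varphi(x)}\,d\mu(x)=0 .$$ -/

import Mathlib

open MeasureTheory Filter Topology
open scoped ComplexConjugate InnerProductSpace

namespace AlpertBasis

/-- A half-open cube in `ℝⁿ` with sides parallel to the axes and side length `2 ^ scale`,
recorded by its lower corner and its scale. -/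
@[ext]
structure DyadicCube (n : ℕ) where
  corner : EuclideanSpace ℝ (Fin n)
  scale : ℤ

namespace DyadicCube

variable {n : ℕ}

/-- The point set `∏ᵢ [cornerᵢ, cornerᵢ + 2 ^ scale)`. -/
def toSet (Q : DyadicCube n) : Set (EuclideanSpace ℝ (Fin n)) :=
  {x | ∀ i, Q.corner i ≤ x i ∧ x i < Q.corner i + (2 : ℝ) ^ Q.scale}

/-- The `2 ^ n` children of a cube, indexed by `ε ∈ {false, true}ⁿ`: the upper half of the `i`-th
side is taken exactly when `ε i = true`. -/
noncomputable def child (Q : DyadicCube n) (ε : Fin n → Bool) : DyadicCube n where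
  corner := WithLp.toLp 2 fun i =>
    Q.corner i + if ε i then (2 : ℝ) ^ (Q.scale - 1) else 0
  scale := Q.scale - 1

end DyadicCube

/-- A dyadic grid in `ℝⁿ`: for every `k : ℤ` the cubes of side length `2 ^ k` in the grid
partition `ℝⁿ`, and every cube of the grid is divided into its `2 ^ n` children by the cubes of
the next smaller generation. (The grid need not be a translate of the standard one.) -/
structure DyadicGrid (n : ℕ) where
  cubes : Set (DyadicCube n)
  existsUnique_cube : ∀ (k : ℤ) (x : EuclideanSpace ℝ (Fin n)),
    ∃! Q : DyadicCube n, Q ∈ cubes ∧ Q.scale = k ∧ x ∈ Q.toSet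
  child_mem : ∀ Q ∈ cubes, ∀ ε : Fin n → Bool, Q.child ε ∈ cubes

namespace DyadicGrid

variable {n : ℕ}

/-- The unique cube of side length `2 ^ k` in the grid that contains `x`. -/
noncomputable def cubeAt (D : DyadicGrid n) (k : ℤ) (x : EuclideanSpace ℝ (Fin n)) :
    DyadicCube n :=
  (D.existsUnique_cube k x).choose

/-- Towers `I₁ ⊆ I₂ ⊆ ⋯` of cubes of the grid, the `m`-th one of side length `2 ^ m`
(`I m` is the member number `m + 1` of the tower). -/
def IsTower (D : DyadicGrid n) (I : ℕ → DyadicCube n) : Prop :=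
  ∀ m : ℕ, I m ∈ D.cubes ∧ (I m).scale = (m : ℤ) + 1 ∧ (I m).toSet ⊆ (I (m + 1)).toSet

/-- The set of tops of the grid: the unions of its towers. Equivalent towers (those that share
a cube) have the same union, so this set has one element for each class of towers. -/
def tops (D : DyadicGrid n) : Set (Set (EuclideanSpace ℝ (Fin n))) :=
  {T | ∃ I : ℕ → DyadicCube n, D.IsTower I ∧ T = ⋃ m, (I m).toSet}

end DyadicGrid

section Spaces

variable {𝕜 : Type*} [RCLike 𝕜] {n : ℕ}

/-- `φ` belongs to `L²_loc(μ)`. -/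
def LocL2 (μ : Measure (EuclideanSpace ℝ (Fin n))) (φ : EuclideanSpace ℝ (Fin n) → 𝕜) : Prop :=
  ∀ K : Set (EuclideanSpace ℝ (Fin n)), IsCompact K → MemLp φ 2 (μ.restrict K)

/-- A subspace of `L²(μ)` all of whose members are represented by values of a linear map
on a finite-dimensional space is finite-dimensional. -/
theorem finiteDimensional_of_forall_exists {V : Type*} [AddCommGroup V] [Module 𝕜 V]
    [FiniteDimensional 𝕜 V] {μ : Measure (EuclideanSpace ℝ (Fin n))}
    (L : V →ₗ[𝕜] (EuclideanSpace ℝ (Fin n) → 𝕜)) (K : Submodule 𝕜 (Lp 𝕜 2 μ))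
    (h : ∀ f ∈ K, ∃ v : V, (f : EuclideanSpace ℝ (Fin n) → 𝕜) =ᵐ[μ] L v) :
    FiniteDimensional 𝕜 K := by
  let A : Submodule 𝕜 (V × Lp 𝕜 2 μ) :=
    { carrier := {z | (z.2 : EuclideanSpace ℝ (Fin n) → 𝕜) =ᵐ[μ] L z.1}
      zero_mem' := by
        simpa using Lp.coeFn_zero 𝕜 2 μ
      add_mem' := by
        intro a b ha hb
        simp only [Set.mem_ofPred_eq, Prod.snd_add, Prod.fst_add, map_add] at *
        exact (Lp.coeFn_add _ _).trans (ha.add hb)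
      smul_mem' := by
        intro c a ha
        simp only [Set.mem_ofPred_eq, Prod.smul_snd, Prod.smul_fst, map_smul] at *
        exact (Lp.coeFn_smul _ _).trans (ha.const_smul c) }
  have hinj : Function.Injective ((LinearMap.fst 𝕜 V (Lp 𝕜 2 μ)).comp A.subtype) := by
    rintro ⟨⟨v, f⟩, hf⟩ ⟨⟨w, g⟩, hg⟩ hvw
    have hvw' : v = w := hvw
    subst hvw'
    have hfg : f = g := by
      apply Lp.ext
      have h1 : (f : EuclideanSpace ℝ (Fin n) → 𝕜) =ᵐ[μ] L v := hf
      have h2 : (g : EuclideanSpace ℝ (Fin n) → 𝕜) =ᵐ[μ] L v := hg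
      exact h1.trans h2.symm
    subst hfg
    rfl
  have hA : FiniteDimensional 𝕜 A := FiniteDimensional.of_injective _ hinj
  have hmap : FiniteDimensional 𝕜 (A.map (LinearMap.snd 𝕜 V (Lp 𝕜 2 μ))) := inferInstance
  refine Submodule.finiteDimensional_of_le (S₂ := A.map (LinearMap.snd 𝕜 V (Lp 𝕜 2 μ))) ?_
  intro f hf
  obtain ⟨v, hv⟩ := h f hf
  exact ⟨(v, f), hv, rfl⟩

variable (μ : Measure (EuclideanSpace ℝ (Fin n)))
  (P : Submodule 𝕜 (EuclideanSpace ℝ (Fin n) → 𝕜))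

/-- The subspace of `L²(μ)` of all functions `1_S φ` with `φ ∈ P` that are in `L²(μ)`. It is used
with `S` a cube, and with `S` a top, where it picks out the `φ ∈ P` that are square integrable
on the top. -/
def localSpace (S : Set (EuclideanSpace ℝ (Fin n))) : Submodule 𝕜 (Lp 𝕜 2 μ) where
  carrier := {f | ∃ φ ∈ P, (f : EuclideanSpace ℝ (Fin n) → 𝕜) =ᵐ[μ] S.indicator φ}
  zero_mem' := ⟨0, P.zero_mem, by simpa using Lp.coeFn_zero 𝕜 2 μ⟩
  add_mem' := by
    rintro f g ⟨φ, hφ, hf⟩ ⟨ψ, hψ, hg⟩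
    refine ⟨φ + ψ, P.add_mem hφ hψ, ?_⟩
    rw [Set.indicator_add']
    exact (Lp.coeFn_add _ _).trans (hf.add hg)
  smul_mem' := by
    rintro c f ⟨φ, hφ, hf⟩
    refine ⟨c • φ, P.smul_mem c hφ, ?_⟩
    have : S.indicator (c • φ) = c • S.indicator φ := Set.indicator_const_smul S c φ
    rw [this]
    exact (Lp.coeFn_smul _ _).trans (hf.const_smul c)

/-- The subspace of `L²(μ)` of all functions `f = ∑_{Q'} 1_{Q'} p_{Q'}`, where `Q'` runs over the
children of `Q` and `p_{Q'} ∈ P`, such that `∫_Q f φ̄ dμ = 0` for every `φ ∈ P`. (The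
integrability clause holds for every `f ∈ L²(μ)` when `P` consists of `L²_loc(μ)` functions.) -/
def alpertSpace (Q : DyadicCube n) : Submodule 𝕜 (Lp 𝕜 2 μ) where
  carrier := {f |
    (∃ p : (Fin n → Bool) → P, (f : EuclideanSpace ℝ (Fin n) → 𝕜) =ᵐ[μ]
      ∑ ε, (Q.child ε).toSet.indicator (p ε : EuclideanSpace ℝ (Fin n) → 𝕜)) ∧
    ∀ φ ∈ P, IntegrableOn (fun x => f x * conj (φ x)) Q.toSet μ ∧
      ∫ x in Q.toSet, f x * conj (φ x) ∂μ = 0}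
  zero_mem' := by
    refine ⟨⟨0, by simpa using Lp.coeFn_zero 𝕜 2 μ⟩, fun φ _ => ?_⟩
    have h0 : (fun x => (0 : Lp 𝕜 2 μ) x * conj (φ x)) =ᵐ[μ.restrict Q.toSet] 0 := by
      filter_upwards [ae_restrict_of_ae (Lp.coeFn_zero 𝕜 2 μ)] with x hx
      rw [hx]
      simp
    exact ⟨(integrable_zero _ _ _).congr h0.symm, by rw [integral_congr_ae h0]; simp⟩
  add_mem' := by
    rintro f g ⟨⟨p, hf⟩, hf'⟩ ⟨⟨q, hg⟩, hg'⟩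
    refine ⟨⟨p + q, ?_⟩, fun φ hφ => ?_⟩
    · have : (∑ ε, (Q.child ε).toSet.indicator
          (((p + q) ε : P) : EuclideanSpace ℝ (Fin n) → 𝕜)) =
          (∑ ε, (Q.child ε).toSet.indicator (p ε : EuclideanSpace ℝ (Fin n) → 𝕜)) +
          ∑ ε, (Q.child ε).toSet.indicator (q ε : EuclideanSpace ℝ (Fin n) → 𝕜) := by
        rw [← Finset.sum_add_distrib]
        refine Finset.sum_congr rfl fun ε _ => ?_
        rw [← Set.indicator_add']
        rfl
      rw [this]
      exact (Lp.coeFn_add _ _).trans (hf.add hg)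
    · have h0 : (fun x => (f + g : Lp 𝕜 2 μ) x * conj (φ x)) =ᵐ[μ.restrict Q.toSet]
          fun x => f x * conj (φ x) + g x * conj (φ x) := by
        filter_upwards [ae_restrict_of_ae (Lp.coeFn_add f g)] with x hx
        rw [hx, Pi.add_apply, add_mul]
      obtain ⟨hi, hz⟩ := hf' φ hφ
      obtain ⟨hi', hz'⟩ := hg' φ hφ
      refine ⟨(hi.add hi').congr h0.symm, ?_⟩
      rw [integral_congr_ae h0, integral_add hi hi', hz, hz', add_zero]
  smul_mem' := by
    rintro c f ⟨⟨p, hf⟩, hf'⟩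
    refine ⟨⟨c • p, ?_⟩, fun φ hφ => ?_⟩
    · have : (∑ ε, (Q.child ε).toSet.indicator
          (((c • p) ε : P) : EuclideanSpace ℝ (Fin n) → 𝕜)) =
          c • ∑ ε, (Q.child ε).toSet.indicator (p ε : EuclideanSpace ℝ (Fin n) → 𝕜) := by
        rw [Finset.smul_sum]
        refine Finset.sum_congr rfl fun ε _ => ?_
        exact Set.indicator_const_smul _ c _
      rw [this]
      exact (Lp.coeFn_smul _ _).trans (hf.const_smul c)
    · have h0 : (fun x => (c • f : Lp 𝕜 2 μ) x * conj (φ x)) =ᵐ[μ.restrict Q.toSet]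
          fun x => c * (f x * conj (φ x)) := by
        filter_upwards [ae_restrict_of_ae (Lp.coeFn_smul c f)] with x hx
        rw [hx, Pi.smul_apply, smul_eq_mul, mul_assoc]
      obtain ⟨hi, hz⟩ := hf' φ hφ
      refine ⟨(hi.const_mul c).congr h0.symm, ?_⟩
      rw [integral_congr_ae h0, integral_const_mul, hz, mul_zero]

instance finiteDimensional_localSpace [FiniteDimensional 𝕜 P]
    (S : Set (EuclideanSpace ℝ (Fin n))) : FiniteDimensional 𝕜 (localSpace μ P S) := by
  let L : P →ₗ[𝕜] (EuclideanSpace ℝ (Fin n) → 𝕜) :=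
    { toFun := fun φ => S.indicator (φ : EuclideanSpace ℝ (Fin n) → 𝕜)
      map_add' := fun φ ψ => Set.indicator_add' S _ _
      map_smul' := fun c φ => Set.indicator_const_smul S c _ }
  refine finiteDimensional_of_forall_exists L _ ?_
  rintro f ⟨φ, hφ, hf⟩
  exact ⟨⟨φ, hφ⟩, hf⟩

instance finiteDimensional_alpertSpace [FiniteDimensional 𝕜 P] (Q : DyadicCube n) :
    FiniteDimensional 𝕜 (alpertSpace μ P Q) := by
  let L : ((Fin n → Bool) → P) →ₗ[𝕜] (EuclideanSpace ℝ (Fin n) → 𝕜) :=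
    { toFun := fun p =>
        ∑ ε, (Q.child ε).toSet.indicator (p ε : EuclideanSpace ℝ (Fin n) → 𝕜)
      map_add' := fun p q => by
        rw [← Finset.sum_add_distrib]
        refine Finset.sum_congr rfl fun ε _ => ?_
        rw [← Set.indicator_add']
        rfl
      map_smul' := fun c p => by
        rw [Finset.smul_sum]
        refine Finset.sum_congr rfl fun ε _ => ?_
        exact Set.indicator_const_smul _ c _ }
  refine finiteDimensional_of_forall_exists L _ ?_
  rintro f ⟨⟨p, hf⟩, -⟩
  exact ⟨p, hf⟩

variable [FiniteDimensional 𝕜 P]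

/-- `𝔼_S`: the orthogonal projection of `L²(μ)` onto `localSpace μ P S`
(`S` is a cube or a top). -/
noncomputable def expProj (S : Set (EuclideanSpace ℝ (Fin n))) : Lp 𝕜 2 μ →L[𝕜] Lp 𝕜 2 μ :=
  (localSpace μ P S).starProjection

/-- `△_Q`: the orthogonal projection of `L²(μ)` onto `alpertSpace μ P Q`. -/
noncomputable def alpertProj (Q : DyadicCube n) : Lp 𝕜 2 μ →L[𝕜] Lp 𝕜 2 μ :=
  (alpertSpace μ P Q).starProjection

end Spaces

end AlpertBasis

/-! Write E_S for the projection onto the local space of S and Δ_Q for the Alpert projection. The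
functions that are piecewise in `P` on the children of Q form the orthogonal sum of the local spaces
of the children. This sum contains the local space of Q, and the Alpert space is the complement of
the latter in it. Hence Δ_Q = ∑ E_{Q'} − E_Q, summed over the children Q' (`alpertProj_eq`).
Orthogonality follows from nesting. Along the cubes that contain x the series telescopes, so
everything reduces to the limits of E_Q f(x) as Q ∋ x grows or shrinks.

Large cubes: if S_m increases to a top, then 1_{S_m} − E_{S_m} is an increasing sequence of
projections, so E_{S_m} converges strongly; the limit is identified by a stabilization argument in
the finite-dimensional space `P` (`mem_localSpace_iUnion`). Restricted to a fixed S_j the terms live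
in a finite-dimensional space, which upgrades the convergence to almost everywhere
(`ae_tendsto_expProj_atTop`).

Small cubes: E_Q h = h on Q for small Q when h is in the span of the local spaces, and this span is
dense because 1 ∈ `P`. What remains is a weak type (2,2) maximal inequality (`measure_maximal_le`).
In general E_Q f has no uniform bound by averages of |f|, so the inequality comes from energies. Let
E_k be the set where k is the largest scale at which the projection exceeds t, and penalize mass on
the E_k of scale at most that of Q with weight s. The maximal energies telescope down the tree and
bound ∑ ‖1_{E_k} y_Q‖² for the maximizers y_Q (`energy_add_treeSum_le`). The maximizer is a
resolvent (1 + sT)⁻¹ E_Q f with 0 ≤ T ≤ 1, and Lagrange interpolation in s recovers E_Q f from the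
resolvents at s = 1, …, dim `P` with bounded coefficients (`exists_resolvent_combination`).

Completeness in L² is then formal: Bessel's inequality gives an unconditional sum, and the pointwise
limits show that a function killed by all the projections is zero
(`eq_zero_of_forall_proj_eq_zero`). -/

namespace AlpertBasis

/-! ### Geometry of a single cube and its children. -/

namespace DyadicCube

variable {n : ℕ}

theorem mem_toSet {Q : DyadicCube n} {x : EuclideanSpace ℝ (Fin n)} :
    x ∈ Q.toSet ↔ ∀ i, Q.corner i ≤ x i ∧ x i < Q.corner i + (2 : ℝ) ^ Q.scale := Iff.rfl

theorem corner_mem (Q : DyadicCube n) : Q.corner ∈ Q.toSet := fun i =>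
  ⟨le_rfl, by linarith [zpow_pos (zero_lt_two' ℝ) Q.scale]⟩

@[simp]
theorem child_scale (Q : DyadicCube n) (ε : Fin n → Bool) : (Q.child ε).scale = Q.scale - 1 := rfl

theorem child_corner (Q : DyadicCube n) (ε : Fin n → Bool) (i : Fin n) :
    (Q.child ε).corner i = Q.corner i + if ε i then (2 : ℝ) ^ (Q.scale - 1) else 0 := rfl

theorem two_zpow_scale (k : ℤ) : (2 : ℝ) ^ k = 2 ^ (k - 1) + 2 ^ (k - 1) := by
  have h : k = (k - 1) + 1 := by ring
  conv_lhs => rw [h, zpow_add_one₀ two_ne_zero]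
  ring

theorem child_subset (Q : DyadicCube n) (ε : Fin n → Bool) : (Q.child ε).toSet ⊆ Q.toSet := by
  intro x hx i
  have h := hx i
  have h2 := two_zpow_scale Q.scale
  have h3 := zpow_pos (zero_lt_two' ℝ) (Q.scale - 1)
  rw [child_corner, child_scale] at h
  split_ifs at h <;> constructor <;> linarith

theorem exists_mem_child {Q : DyadicCube n} {x : EuclideanSpace ℝ (Fin n)} (hx : x ∈ Q.toSet) :
    ∃ ε, x ∈ (Q.child ε).toSet := by
  refine ⟨fun i => decide (Q.corner i + (2 : ℝ) ^ (Q.scale - 1) ≤ x i), fun i => ?_⟩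
  have h := hx i
  have h2 := two_zpow_scale Q.scale
  rw [child_corner, child_scale]
  by_cases hi : Q.corner i + (2 : ℝ) ^ (Q.scale - 1) ≤ x i
  · rw [decide_eq_true hi, if_pos rfl]
    constructor <;> linarith
  · rw [decide_eq_false hi, if_neg Bool.false_ne_true]
    constructor <;> linarith

theorem disjoint_child (Q : DyadicCube n) {ε ε' : Fin n → Bool} (h : ε ≠ ε') :
    Disjoint (Q.child ε).toSet (Q.child ε').toSet := by
  obtain ⟨i, hi⟩ := Function.ne_iff.1 h
  rw [Set.disjoint_left]
  intro x hx hx'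
  have h1 := hx i
  have h2 := hx' i
  rw [child_corner, child_scale] at h1 h2
  cases h3 : ε i <;> cases h4 : ε' i <;> simp_all <;> linarith

theorem iUnion_child (Q : DyadicCube n) : ⋃ ε, (Q.child ε).toSet = Q.toSet := by
  ext x
  rw [Set.mem_iUnion]
  exact ⟨fun ⟨ε, h⟩ => Q.child_subset ε h, exists_mem_child⟩

theorem measurableSet_toSet (Q : DyadicCube n) : MeasurableSet Q.toSet := by
  have : Q.toSet = ⋂ i, {x | Q.corner i ≤ x i ∧ x i < Q.corner i + (2 : ℝ) ^ Q.scale} := by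
    ext x; simp [mem_toSet]
  rw [this]
  refine MeasurableSet.iInter fun i => ?_
  have hm : Measurable fun x : EuclideanSpace ℝ (Fin n) => x i :=
    (by fun_prop : Continuous fun x : EuclideanSpace ℝ (Fin n) => x i).measurable
  exact (measurableSet_le measurable_const hm).inter (measurableSet_lt hm measurable_const)

/-- The closed cube with the same corners is compact. -/
theorem exists_isCompact_superset (Q : DyadicCube n) : ∃ K, IsCompact K ∧ Q.toSet ⊆ K := by
  let e := EuclideanSpace.equiv (Fin n) ℝ
  refine ⟨e ⁻¹' (Set.Icc (fun i => Q.corner i) fun i => Q.corner i + (2 : ℝ) ^ Q.scale), ?_, ?_⟩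
  · exact e.toHomeomorph.isCompact_preimage.2 isCompact_Icc
  · intro x hx
    exact ⟨fun i => (hx i).1, fun i => (hx i).2.le⟩

theorem exists_isOpen_subset (Q : DyadicCube n) :
    ∃ U : Set (EuclideanSpace ℝ (Fin n)), IsOpen U ∧ U.Nonempty ∧ U ⊆ Q.toSet := by
  refine ⟨⋂ i, {x | Q.corner i < x i ∧ x i < Q.corner i + (2 : ℝ) ^ Q.scale}, ?_, ?_, ?_⟩
  · refine isOpen_iInter_of_finite fun i => ?_
    have hc : Continuous fun x : EuclideanSpace ℝ (Fin n) => x i := by fun_prop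
    exact (isOpen_lt continuous_const hc).inter (isOpen_lt hc continuous_const)
  · refine ⟨WithLp.toLp 2 fun i => Q.corner i + (2 : ℝ) ^ (Q.scale - 1), ?_⟩
    rw [Set.mem_iInter]
    intro i
    have h2 := two_zpow_scale Q.scale
    have h3 := zpow_pos (zero_lt_two' ℝ) (Q.scale - 1)
    constructor <;> simp only <;> linarith
  · intro x hx i
    rw [Set.mem_iInter] at hx
    exact ⟨(hx i).1.le, (hx i).2⟩

/-- If Q were longer, it would contain its own corner shifted by the side length of R, which lies
beyond R. Dimension 0 must be excluded: there every cube is the whole one-point space. -/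
theorem scale_le_of_subset [NeZero n] {Q R : DyadicCube n} (h : Q.toSet ⊆ R.toSet) :
    Q.scale ≤ R.scale := by
  by_contra! hlt
  have h1 := h Q.corner_mem 0
  have hlt' : (2 : ℝ) ^ R.scale < 2 ^ Q.scale := zpow_lt_zpow_right₀ one_lt_two hlt
  have h3 := zpow_pos (zero_lt_two' ℝ) R.scale
  have hm : (WithLp.toLp 2 fun i => Q.corner i + (2 : ℝ) ^ R.scale :
      EuclideanSpace ℝ (Fin n)) ∈ Q.toSet := fun i => by
    constructor <;> simp only <;> linarith
  have h2 := (h hm 0).2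
  simp only at h2
  linarith

theorem dist_le_of_mem {Q : DyadicCube n} {x y : EuclideanSpace ℝ (Fin n)}
    (hx : x ∈ Q.toSet) (hy : y ∈ Q.toSet) : dist x y ≤ √n * 2 ^ Q.scale := by
  have h3 := zpow_pos (zero_lt_two' ℝ) Q.scale
  rw [EuclideanSpace.dist_eq]
  refine Real.sqrt_le_iff.2 ⟨by positivity, ?_⟩
  calc ∑ i, dist (x i) (y i) ^ 2 ≤ ∑ _i : Fin n, ((2 : ℝ) ^ Q.scale) ^ 2 := by
        refine Finset.sum_le_sum fun i _ => ?_
        gcongr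
        rw [Real.dist_eq, abs_le]
        have h1 := hx i
        have h2 := hy i
        constructor <;> linarith
    _ = _ := by
        rw [mul_pow, Real.sq_sqrt (Nat.cast_nonneg n)]
        simp

end DyadicCube

/-! ### Nesting, countability and tops of a dyadic grid. -/

namespace DyadicGrid

variable {n : ℕ} (D : DyadicGrid n)

theorem cubeAt_mem (k : ℤ) (x : EuclideanSpace ℝ (Fin n)) : D.cubeAt k x ∈ D.cubes :=
  (D.existsUnique_cube k x).choose_spec.1.1

@[simp]
theorem cubeAt_scale (k : ℤ) (x : EuclideanSpace ℝ (Fin n)) : (D.cubeAt k x).scale = k :=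
  (D.existsUnique_cube k x).choose_spec.1.2.1

theorem mem_cubeAt (k : ℤ) (x : EuclideanSpace ℝ (Fin n)) : x ∈ (D.cubeAt k x).toSet :=
  (D.existsUnique_cube k x).choose_spec.1.2.2

variable {D}

theorem eq_of_mem {Q R : DyadicCube n} (hQ : Q ∈ D.cubes) (hR : R ∈ D.cubes)
    (hs : Q.scale = R.scale) {x : EuclideanSpace ℝ (Fin n)} (hx : x ∈ Q.toSet)
    (hx' : x ∈ R.toSet) : Q = R :=
  (D.existsUnique_cube R.scale x).unique ⟨hQ, hs, hx⟩ ⟨hR, rfl, hx'⟩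

theorem cubeAt_eq {Q : DyadicCube n} (hQ : Q ∈ D.cubes) {k : ℤ} (hk : Q.scale = k)
    {x : EuclideanSpace ℝ (Fin n)} (hx : x ∈ Q.toSet) : D.cubeAt k x = Q :=
  eq_of_mem (D.cubeAt_mem k x) hQ (by simp [hk]) (D.mem_cubeAt k x) hx

/-- Descend from R through the children that contain x until the scale of Q is reached; uniqueness
at that scale makes the last one equal to Q. -/
theorem subset_of_mem {Q R : DyadicCube n} (hQ : Q ∈ D.cubes) (hR : R ∈ D.cubes)
    (hs : Q.scale ≤ R.scale) {x : EuclideanSpace ℝ (Fin n)} (hx : x ∈ Q.toSet)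
    (hx' : x ∈ R.toSet) : Q.toSet ⊆ R.toSet := by
  obtain ⟨m, hm⟩ := Int.le.dest hs
  induction m generalizing R with
  | zero =>
    rw [eq_of_mem hQ hR (by simpa using hm) hx hx']
  | succ m ih =>
    obtain ⟨ε, hε⟩ := DyadicCube.exists_mem_child hx'
    have h1 : Q.scale + m = (R.child ε).scale := by
      rw [DyadicCube.child_scale, ← hm]; push_cast; ring
    exact (ih (D.child_mem R hR ε) (by omega) hε h1).trans (R.child_subset ε)

theorem disjoint_or_subset {Q R : DyadicCube n} (hQ : Q ∈ D.cubes) (hR : R ∈ D.cubes)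
    (hs : Q.scale ≤ R.scale) : Disjoint Q.toSet R.toSet ∨ Q.toSet ⊆ R.toSet := by
  by_cases h : Disjoint Q.toSet R.toSet
  · exact Or.inl h
  · obtain ⟨x, hx, hx'⟩ := Set.not_disjoint_iff.1 h
    exact Or.inr (subset_of_mem hQ hR hs hx hx')

theorem disjoint_of_ne {Q R : DyadicCube n} (hQ : Q ∈ D.cubes) (hR : R ∈ D.cubes)
    (hs : Q.scale = R.scale) (h : Q ≠ R) : Disjoint Q.toSet R.toSet := by
  by_contra hd
  obtain ⟨x, hx, hx'⟩ := Set.not_disjoint_iff.1 hd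
  exact h (eq_of_mem hQ hR hs hx hx')

theorem disjoint_or_subset_child {Q R : DyadicCube n} (hQ : Q ∈ D.cubes) (hR : R ∈ D.cubes)
    (hs : Q.scale < R.scale) :
    Disjoint Q.toSet R.toSet ∨ ∃ ε, Q.toSet ⊆ (R.child ε).toSet := by
  by_cases h : Disjoint Q.toSet R.toSet
  · exact Or.inl h
  · obtain ⟨x, hx, hx'⟩ := Set.not_disjoint_iff.1 h
    obtain ⟨ε, hε⟩ := DyadicCube.exists_mem_child hx'
    exact Or.inr ⟨ε, subset_of_mem hQ (D.child_mem R hR ε)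
      (by rw [DyadicCube.child_scale]; omega) hx hε⟩

theorem cubeAt_mono {j k : ℤ} (h : j ≤ k) (x : EuclideanSpace ℝ (Fin n)) :
    (D.cubeAt j x).toSet ⊆ (D.cubeAt k x).toSet :=
  subset_of_mem (D.cubeAt_mem j x) (D.cubeAt_mem k x) (by simpa) (D.mem_cubeAt j x)
    (D.mem_cubeAt k x)

variable (D)

theorem countable_cubes : D.cubes.Countable := by
  obtain ⟨s, hs, hd⟩ := TopologicalSpace.exists_countable_dense (EuclideanSpace ℝ (Fin n))
  have hc : ((fun p : ℤ × EuclideanSpace ℝ (Fin n) => D.cubeAt p.1 p.2) ''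
      (Set.univ ×ˢ s)).Countable := (Set.countable_univ.prod hs).image _
  refine hc.mono fun Q hQ => ?_
  obtain ⟨U, hU, hne, hsub⟩ := Q.exists_isOpen_subset
  obtain ⟨x, hx, hxs⟩ := hd.inter_open_nonempty U hU hne
  exact ⟨(Q.scale, x), ⟨Set.mem_univ _, hxs⟩, cubeAt_eq hQ rfl (hsub hx)⟩

instance : Countable D.cubes := D.countable_cubes.to_subtype

variable {D}

theorem exists_cubeAt_subset {U : Set (EuclideanSpace ℝ (Fin n))} (hU : IsOpen U)
    {x : EuclideanSpace ℝ (Fin n)} (hx : x ∈ U) : ∃ k : ℤ, (D.cubeAt k x).toSet ⊆ U := by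
  obtain ⟨r, hr, hb⟩ := Metric.isOpen_iff.1 hU x hx
  obtain ⟨m, hm⟩ := exists_pow_lt_of_lt_one (show 0 < r / (√n + 1) by positivity)
    (show (1 / 2 : ℝ) < 1 by norm_num)
  refine ⟨-(m : ℤ), fun y hy => hb ?_⟩
  have h := DyadicCube.dist_le_of_mem hy (D.mem_cubeAt _ x)
  rw [Metric.mem_ball]
  have h2 : (2 : ℝ) ^ (-(m : ℤ)) = (1 / 2) ^ m := by simp
  rw [cubeAt_scale, h2] at h
  rw [lt_div_iff₀ (by positivity)] at hm
  have : (0 : ℝ) < (1 / 2) ^ m := by positivity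
  nlinarith

/-- The cubes of a dyadic grid generate the Borel σ-algebra. -/
theorem borel_eq_generateFrom (D : DyadicGrid n) :
    (inferInstance : MeasurableSpace (EuclideanSpace ℝ (Fin n))) =
      MeasurableSpace.generateFrom (DyadicCube.toSet '' D.cubes) := by
  apply le_antisymm
  · rw [BorelSpace.measurable_eq (α := EuclideanSpace ℝ (Fin n))]
    refine MeasurableSpace.generateFrom_le fun U hU => ?_
    have : U = ⋃ Q ∈ {Q ∈ D.cubes | Q.toSet ⊆ U}, Q.toSet := by
      ext x
      simp only [Set.mem_iUnion, exists_prop]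
      refine ⟨fun hx => ?_, fun ⟨Q, hQ, hx⟩ => hQ.2 hx⟩
      obtain ⟨k, hk⟩ := exists_cubeAt_subset (D := D) hU hx
      exact ⟨_, ⟨D.cubeAt_mem k x, hk⟩, D.mem_cubeAt k x⟩
    rw [this]
    refine MeasurableSet.biUnion (D.countable_cubes.mono fun Q hQ => hQ.1) fun Q hQ => ?_
    exact MeasurableSpace.measurableSet_generateFrom ⟨Q, hQ.1, rfl⟩
  · refine MeasurableSpace.generateFrom_le ?_
    rintro _ ⟨Q, -, rfl⟩
    exact Q.measurableSet_toSet

theorem isPiSystem_cubes (D : DyadicGrid n) : IsPiSystem (DyadicCube.toSet '' D.cubes) := by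
  rintro _ ⟨Q, hQ, rfl⟩ _ ⟨R, hR, rfl⟩ ⟨x, hx, hx'⟩
  rcases le_total Q.scale R.scale with h | h
  · rw [Set.inter_eq_left.2 (subset_of_mem hQ hR h hx hx')]
    exact ⟨Q, hQ, rfl⟩
  · rw [Set.inter_eq_right.2 (subset_of_mem hR hQ h hx' hx)]
    exact ⟨R, hR, rfl⟩

/-- The top that contains a given point. -/
def topAt (D : DyadicGrid n) (x : EuclideanSpace ℝ (Fin n)) : Set (EuclideanSpace ℝ (Fin n)) :=
  ⋃ m : ℕ, (D.cubeAt ((m : ℤ) + 1) x).toSet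

theorem topAt_mem_tops (x : EuclideanSpace ℝ (Fin n)) : D.topAt x ∈ D.tops :=
  ⟨fun m => D.cubeAt ((m : ℤ) + 1) x,
    fun m => ⟨D.cubeAt_mem _ x, D.cubeAt_scale _ x, cubeAt_mono (by push_cast; omega) x⟩, rfl⟩

theorem cubeAt_subset_topAt (k : ℤ) (x : EuclideanSpace ℝ (Fin n)) :
    (D.cubeAt k x).toSet ⊆ D.topAt x :=
  (cubeAt_mono (by omega : k ≤ (k.toNat : ℤ) + 1) x).trans
    (Set.subset_iUnion (fun m : ℕ => (D.cubeAt ((m : ℤ) + 1) x).toSet) k.toNat)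

theorem mem_topAt (x : EuclideanSpace ℝ (Fin n)) : x ∈ D.topAt x :=
  cubeAt_subset_topAt 0 x (D.mem_cubeAt 0 x)

theorem cubeAt_eq_cubeAt {j k : ℤ} (h : j ≤ k) {x y : EuclideanSpace ℝ (Fin n)}
    (hy : y ∈ (D.cubeAt j x).toSet) : D.cubeAt k y = D.cubeAt k x :=
  cubeAt_eq (D.cubeAt_mem k x) (D.cubeAt_scale k x) (cubeAt_mono h x hy)

theorem topAt_eq_of_mem_cubeAt {x y : EuclideanSpace ℝ (Fin n)} {k : ℤ}
    (hy : y ∈ (D.cubeAt k x).toSet) : D.topAt y = D.topAt x := by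
  have key : ∀ u v, (∀ j, k ≤ j → D.cubeAt j u = D.cubeAt j v) → D.topAt u ⊆ D.topAt v := by
    intro u v h z hz
    obtain ⟨m, hm⟩ := Set.mem_iUnion.1 hz
    have h1 := cubeAt_mono (D := D) (le_max_left ((m : ℤ) + 1) k) u hm
    rw [h _ (le_max_right _ _)] at h1
    exact cubeAt_subset_topAt _ v h1
  exact (key y x fun j hj => cubeAt_eq_cubeAt hj hy).antisymm
    (key x y fun j hj => (cubeAt_eq_cubeAt hj hy).symm)

theorem topAt_eq_of_mem {x y : EuclideanSpace ℝ (Fin n)} (hy : y ∈ D.topAt x) :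
    D.topAt y = D.topAt x := by
  obtain ⟨m, hm⟩ := Set.mem_iUnion.1 hy
  exact topAt_eq_of_mem_cubeAt hm

theorem exists_eq_topAt {T : Set (EuclideanSpace ℝ (Fin n))} (hT : T ∈ D.tops) :
    ∃ x, T = D.topAt x := by
  obtain ⟨I, hI, rfl⟩ := hT
  have hmono : Monotone fun m => (I m).toSet := monotone_nat_of_le_succ fun m => (hI m).2.2
  refine ⟨(I 0).corner, Set.iUnion_congr fun m => ?_⟩
  rw [cubeAt_eq (hI m).1 (hI m).2.1 (hmono (Nat.zero_le m) (I 0).corner_mem)]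

theorem eq_topAt {T : Set (EuclideanSpace ℝ (Fin n))} (hT : T ∈ D.tops)
    {x : EuclideanSpace ℝ (Fin n)} (hx : x ∈ T) : T = D.topAt x := by
  obtain ⟨y, rfl⟩ := exists_eq_topAt hT
  exact (topAt_eq_of_mem hx).symm

theorem disjoint_tops {T T' : Set (EuclideanSpace ℝ (Fin n))} (hT : T ∈ D.tops)
    (hT' : T' ∈ D.tops) (h : T ≠ T') : Disjoint T T' := by
  rw [Set.disjoint_left]
  intro x hx hx'
  exact h ((eq_topAt hT hx).trans (eq_topAt hT' hx').symm)

theorem disjoint_or_subset_top {Q : DyadicCube n} (hQ : Q ∈ D.cubes)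
    {T : Set (EuclideanSpace ℝ (Fin n))} (hT : T ∈ D.tops) :
    Disjoint Q.toSet T ∨ Q.toSet ⊆ T := by
  by_cases h : Disjoint Q.toSet T
  · exact Or.inl h
  · obtain ⟨x, hx, hx'⟩ := Set.not_disjoint_iff.1 h
    rw [eq_topAt hT hx', ← cubeAt_eq hQ rfl hx]
    exact Or.inr (cubeAt_subset_topAt _ x)

theorem measurableSet_top {T : Set (EuclideanSpace ℝ (Fin n))} (hT : T ∈ D.tops) :
    MeasurableSet T := by
  obtain ⟨I, -, rfl⟩ := hT
  exact MeasurableSet.iUnion fun m => (I m).measurableSet_toSet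

/-- A cube that meets a box with shorter sides contains a vertex of the box. -/
theorem exists_vertex_mem {Q : DyadicCube n} {r : ℝ} (hr : 2 * r < 2 ^ Q.scale)
    {x : EuclideanSpace ℝ (Fin n)} (hx : x ∈ Q.toSet) (hxr : ∀ i, |x i| ≤ r) :
    ∃ ε : Fin n → Bool,
      (WithLp.toLp 2 fun i => if ε i then r else -r : EuclideanSpace ℝ (Fin n)) ∈ Q.toSet := by
  -- If the side starts to the right of −r, it starts at or before `x i` ≤ r and is longer than 2r,
  -- so it covers r; otherwise it still reaches `x i` ≥ −r, so it covers −r.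
  refine ⟨fun i => decide (-r < Q.corner i), fun i => ?_⟩
  have h1 := hx i
  have h2 := abs_le.1 (hxr i)
  by_cases h : -r < Q.corner i
  · simp only [h, decide_true, if_true]
    constructor <;> linarith
  · simp only [h, decide_false, Bool.false_eq_true, if_false]
    constructor <;> linarith

/-- Pigeonhole on the vertices of a box: pick a point in each top and a box around the origin that
contains them all. The cube of a large enough common scale around each point contains a vertex of
the box, and two tops with the same vertex coincide. Stating this for finite subsets lets it yield
finiteness as well. -/
theorem card_tops_le (s : Finset (Set (EuclideanSpace ℝ (Fin n)))) (hs : (s : Set _) ⊆ D.tops) :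
    s.card ≤ 2 ^ n := by
  by_contra! hlt
  choose x hx using fun T : s => exists_eq_topAt (hs T.2)
  let r : ℝ := ∑ T : s, ‖x T‖
  have hr : ∀ T i, |x T i| ≤ r := fun T i =>
    (PiLp.norm_apply_le (x T) i).trans
      (Finset.single_le_sum (f := fun T => ‖x T‖) (fun _ _ => norm_nonneg _) (Finset.mem_univ T))
  obtain ⟨m, hm⟩ := pow_unbounded_of_one_lt (2 * r) (one_lt_two (α := ℝ))
  choose ε hε using fun T : s => exists_vertex_mem (Q := D.cubeAt m (x T)) (r := r)
    (by rwa [cubeAt_scale, zpow_natCast]) (D.mem_cubeAt m (x T)) (hr T)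
  obtain ⟨T, T', hne, heq⟩ := Fintype.exists_ne_map_eq_of_card_lt ε (by simpa using hlt)
  refine hne (Subtype.ext ?_)
  have h1 := topAt_eq_of_mem_cubeAt (hε T)
  have h2 := topAt_eq_of_mem_cubeAt (hε T')
  rw [hx T, hx T', ← h1, ← h2, heq]

theorem finite_tops (D : DyadicGrid n) : D.tops.Finite := by
  by_contra h
  obtain ⟨s, hs, hc⟩ := Set.Infinite.exists_subset_card_eq h (2 ^ n + 1)
  have := card_tops_le s hs
  omega

end DyadicGrid

/-! ### Multiplication by an indicator function as an orthogonal projection of L². -/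

section Cut

variable {𝕜 : Type*} [RCLike 𝕜] {α : Type*} [MeasurableSpace α]

theorem memLp_indicator_coeFn {μ : Measure α} {S : Set α} (hS : MeasurableSet S) (f : Lp 𝕜 2 μ) :
    MemLp (S.indicator (⇑f)) 2 μ := MemLp.indicator hS (Lp.memLp f)

/-- The product of an element of `L²(μ)` and the indicator function of a measurable set. -/
noncomputable def indicatorLp (μ : Measure α) {S : Set α} (hS : MeasurableSet S)
    (f : Lp 𝕜 2 μ) : Lp 𝕜 2 μ :=
  MemLp.toLp (S.indicator (⇑f)) (memLp_indicator_coeFn hS f)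

theorem indicatorLp_coeFn (μ : Measure α) {S : Set α} (hS : MeasurableSet S) (f : Lp 𝕜 2 μ) :
    indicatorLp μ hS f =ᵐ[μ] S.indicator f :=
  MemLp.coeFn_toLp (memLp_indicator_coeFn hS f)

theorem indicatorLp_add (μ : Measure α) {S : Set α} (hS : MeasurableSet S) (f g : Lp 𝕜 2 μ) :
    indicatorLp μ hS (f + g) = indicatorLp μ hS f + indicatorLp μ hS g := by
  apply Lp.ext
  filter_upwards [indicatorLp_coeFn μ hS (f + g), indicatorLp_coeFn μ hS f,
    indicatorLp_coeFn μ hS g, Lp.coeFn_add f g,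
    Lp.coeFn_add (indicatorLp μ hS f) (indicatorLp μ hS g)] with x h1 h2 h3 h4 h5
  rw [h5, Pi.add_apply, h1, h2, h3]
  by_cases hx : x ∈ S <;> simp only [hx, Set.indicator_of_mem, Set.indicator_of_notMem,
    not_false_eq_true, h4, Pi.add_apply, add_zero]

theorem indicatorLp_smul (μ : Measure α) {S : Set α} (hS : MeasurableSet S) (c : 𝕜)
    (f : Lp 𝕜 2 μ) : indicatorLp μ hS (c • f) = c • indicatorLp μ hS f := by
  apply Lp.ext
  filter_upwards [indicatorLp_coeFn μ hS (c • f), indicatorLp_coeFn μ hS f,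
    Lp.coeFn_smul c f, Lp.coeFn_smul c (indicatorLp μ hS f)] with x h1 h2 h4 h5
  rw [h5, Pi.smul_apply, h1, h2]
  by_cases hx : x ∈ S <;> simp only [hx, Set.indicator_of_mem, Set.indicator_of_notMem,
    not_false_eq_true, h4, Pi.smul_apply, smul_zero]

theorem norm_indicatorLp_le (μ : Measure α) {S : Set α} (hS : MeasurableSet S) (f : Lp 𝕜 2 μ) :
    ‖indicatorLp μ hS f‖ ≤ ‖f‖ := by
  refine Lp.norm_le_norm_of_ae_le ?_
  filter_upwards [indicatorLp_coeFn μ hS f] with x hx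
  rw [hx]
  exact norm_indicator_le_norm_self _ _

open Classical in
/-- Multiplication by the indicator function of a measurable set, as an operator on `L²(μ)`. -/
noncomputable def cut (μ : Measure α) (S : Set α) : Lp 𝕜 2 μ →L[𝕜] Lp 𝕜 2 μ :=
  -- The value 0 at nonmeasurable sets makes the operator total in the set and keeps the norm bound
  -- free of hypotheses.
  if hS : MeasurableSet S then
    LinearMap.mkContinuous
      { toFun := indicatorLp μ hS
        map_add' := indicatorLp_add μ hS
        map_smul' := indicatorLp_smul μ hS }
      1 fun f => (norm_indicatorLp_le μ hS f).trans_eq (one_mul _).symm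
  else 0

variable {μ : Measure α} {S S' : Set α}

theorem cut_coeFn (hS : MeasurableSet S) (f : Lp 𝕜 2 μ) : cut μ S f =ᵐ[μ] S.indicator f := by
  rw [cut, dif_pos hS]
  exact indicatorLp_coeFn μ hS f

theorem eq_cut_of_ae_eq (hS : MeasurableSet S) {f g : Lp 𝕜 2 μ} (h : g =ᵐ[μ] S.indicator f) :
    g = cut μ S f :=
  Lp.ext (h.trans (cut_coeFn hS f).symm)

theorem cut_cut (hS : MeasurableSet S) (hS' : MeasurableSet S') (f : Lp 𝕜 2 μ) :
    cut μ S (cut μ S' f) = cut μ (S ∩ S') f := by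
  refine eq_cut_of_ae_eq (hS.inter hS') ?_
  filter_upwards [cut_coeFn hS (cut μ S' f), cut_coeFn hS' f] with x h1 h2
  rw [h1, ← Set.indicator_indicator]
  by_cases hx : x ∈ S <;> simp [hx, h2]

theorem cut_comm (hS : MeasurableSet S) (hS' : MeasurableSet S') (f : Lp 𝕜 2 μ) :
    cut μ S (cut μ S' f) = cut μ S' (cut μ S f) := by
  rw [cut_cut hS hS', cut_cut hS' hS, Set.inter_comm]

theorem cut_empty (f : Lp 𝕜 2 μ) : cut μ (∅ : Set α) f = 0 := by
  apply Lp.ext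
  filter_upwards [cut_coeFn MeasurableSet.empty f, Lp.coeFn_zero 𝕜 2 μ] with x h1 h2
  rw [h1, h2, Set.indicator_empty, Pi.zero_apply]

theorem cut_cut_of_disjoint (hS : MeasurableSet S) (hS' : MeasurableSet S') (h : Disjoint S S')
    (f : Lp 𝕜 2 μ) : cut μ S (cut μ S' f) = 0 := by
  rw [cut_cut hS hS', h.inter_eq, cut_empty]

theorem cut_union (hS : MeasurableSet S) (hS' : MeasurableSet S') (h : Disjoint S S')
    (f : Lp 𝕜 2 μ) : cut μ (S ∪ S') f = cut μ S f + cut μ S' f := by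
  symm
  refine eq_cut_of_ae_eq (hS.union hS') ?_
  filter_upwards [cut_coeFn hS f, cut_coeFn hS' f, Lp.coeFn_add (cut μ S f) (cut μ S' f)]
    with x h1 h2 h3
  rw [h3, Pi.add_apply, h1, h2, Set.indicator_union_of_disjoint h]

theorem cut_inner (hS : MeasurableSet S) (f g : Lp 𝕜 2 μ) :
    ⟪cut μ S f, g⟫_𝕜 = ⟪f, cut μ S g⟫_𝕜 := by
  rw [L2.inner_def, L2.inner_def]
  refine integral_congr_ae ?_
  filter_upwards [cut_coeFn hS f, cut_coeFn hS g] with x h1 h2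
  rw [h1, h2]
  by_cases hx : x ∈ S <;> simp [hx]

theorem cut_self_inner (hS : MeasurableSet S) (f g : Lp 𝕜 2 μ) :
    ⟪cut μ S f, cut μ S g⟫_𝕜 = ⟪f, cut μ S g⟫_𝕜 := by
  rw [cut_inner hS, cut_cut hS hS, Set.inter_self]

theorem cut_self (hS : MeasurableSet S) (f : Lp 𝕜 2 μ) : cut μ S (cut μ S f) = cut μ S f := by
  rw [cut_cut hS hS, Set.inter_self]

theorem cut_cut_eq (hS : MeasurableSet S) (hS' : MeasurableSet S') (h : S ⊆ S') {f : Lp 𝕜 2 μ}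
    (hf : cut μ S f = f) : cut μ S' f = f := by
  rw [← hf, cut_cut hS' hS, Set.inter_eq_right.2 h]

theorem norm_cut_le (f : Lp 𝕜 2 μ) : ‖cut μ S f‖ ≤ ‖f‖ := by
  by_cases hS : MeasurableSet S
  · refine Lp.norm_le_norm_of_ae_le ?_
    filter_upwards [cut_coeFn hS f] with x hx
    rw [hx]
    exact norm_indicator_le_norm_self _ _
  · rw [cut, dif_neg hS]
    simp

theorem inner_eq_zero_of_disjoint (hS : MeasurableSet S) (hS' : MeasurableSet S')
    (h : Disjoint S S') {f g : Lp 𝕜 2 μ} (hf : cut μ S f = f) (hg : cut μ S' g = g) :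
    ⟪f, g⟫_𝕜 = 0 := by
  rw [← hf, ← hg, cut_inner hS, cut_cut_of_disjoint hS hS' h, inner_zero_right]

theorem norm_cut_union_sq (hS : MeasurableSet S) (hS' : MeasurableSet S') (h : Disjoint S S')
    (f : Lp 𝕜 2 μ) : ‖cut μ (S ∪ S') f‖ ^ 2 = ‖cut μ S f‖ ^ 2 + ‖cut μ S' f‖ ^ 2 := by
  have := norm_add_sq_eq_norm_sq_add_norm_sq_of_inner_eq_zero (𝕜 := 𝕜) (cut μ S f) (cut μ S' f)
    (inner_eq_zero_of_disjoint hS hS' h (cut_self hS f) (cut_self hS' f))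
  rw [cut_union hS hS' h, sq, sq, sq, this]

theorem cut_biUnion {ι : Type*} {s : Finset ι} {A : ι → Set α}
    (hA : ∀ i, MeasurableSet (A i)) (hd : Pairwise (Function.onFun Disjoint A)) (f : Lp 𝕜 2 μ) :
    cut μ (⋃ i ∈ s, A i) f = ∑ i ∈ s, cut μ (A i) f := by
  classical
  induction s using Finset.induction_on with
  | empty => simp [cut_empty]
  | insert a s ha ih =>
    rw [Finset.sum_insert ha, Finset.set_biUnion_insert, cut_union (hA a) _ _, ih]
    · exact Finset.measurableSet_biUnion s fun i _ => hA i
    · rw [Set.disjoint_iUnion₂_right]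
      exact fun i hi => hd (by rintro rfl; exact ha hi)

theorem norm_cut_biUnion_sq {ι : Type*} {s : Finset ι} {A : ι → Set α}
    (hA : ∀ i, MeasurableSet (A i)) (hd : Pairwise (Function.onFun Disjoint A)) (f : Lp 𝕜 2 μ) :
    ‖cut μ (⋃ i ∈ s, A i) f‖ ^ 2 = ∑ i ∈ s, ‖cut μ (A i) f‖ ^ 2 := by
  classical
  induction s using Finset.induction_on with
  | empty => simp [cut_empty]
  | insert a s ha ih =>
    rw [Finset.sum_insert ha, Finset.set_biUnion_insert, norm_cut_union_sq (hA a) _ _, ih]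
    · exact Finset.measurableSet_biUnion s fun i _ => hA i
    · rw [Set.disjoint_iUnion₂_right]
      exact fun i hi => hd (by rintro rfl; exact ha hi)

end Cut

/-! ### Local spaces, Alpert spaces and their projections. -/

section Projections

variable {𝕜 : Type*} [RCLike 𝕜] {n : ℕ} {μ : Measure (EuclideanSpace ℝ (Fin n))}
  {P : Submodule 𝕜 (EuclideanSpace ℝ (Fin n) → 𝕜)}

theorem sum_cut_child (Q : DyadicCube n) (f : Lp 𝕜 2 μ) :
    ∑ ε, cut μ (Q.child ε).toSet f = cut μ Q.toSet f := by
  rw [← cut_biUnion (fun ε => (Q.child ε).measurableSet_toSet)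
    (fun _ _ h => Q.disjoint_child h)]
  simp [Q.iUnion_child]

theorem sum_norm_cut_child_sq (Q : DyadicCube n) (f : Lp 𝕜 2 μ) :
    ∑ ε, ‖cut μ (Q.child ε).toSet f‖ ^ 2 = ‖cut μ Q.toSet f‖ ^ 2 := by
  rw [← norm_cut_biUnion_sq (fun ε => (Q.child ε).measurableSet_toSet)
    (fun _ _ h => Q.disjoint_child h)]
  simp [Q.iUnion_child]

theorem cut_eq_of_mem_localSpace {S : Set (EuclideanSpace ℝ (Fin n))} (hS : MeasurableSet S)
    {f : Lp 𝕜 2 μ} (hf : f ∈ localSpace μ P S) : cut μ S f = f := by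
  obtain ⟨φ, -, h⟩ := hf
  symm
  refine eq_cut_of_ae_eq hS ?_
  filter_upwards [h] with x hx
  by_cases hxS : x ∈ S <;> simp [hx, hxS]

theorem cut_mem_localSpace {S S' : Set (EuclideanSpace ℝ (Fin n))} (hS : MeasurableSet S)
    (h : S ⊆ S') {f : Lp 𝕜 2 μ} (hf : f ∈ localSpace μ P S') : cut μ S f ∈ localSpace μ P S := by
  obtain ⟨φ, hφ, hf⟩ := hf
  refine ⟨φ, hφ, ?_⟩
  filter_upwards [cut_coeFn hS f, hf] with x h1 h2
  rw [h1]
  by_cases hx : x ∈ S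
  · rw [Set.indicator_of_mem hx, Set.indicator_of_mem hx, h2, Set.indicator_of_mem (h hx)]
  · simp [hx]

theorem memLp_indicator (hP : ∀ φ ∈ P, LocL2 μ φ) (Q : DyadicCube n)
    {φ : EuclideanSpace ℝ (Fin n) → 𝕜} (hφ : φ ∈ P) : MemLp (Q.toSet.indicator φ) 2 μ := by
  obtain ⟨K, hK, hQK⟩ := Q.exists_isCompact_superset
  rw [memLp_indicator_iff_restrict Q.measurableSet_toSet]
  exact (hP φ hφ K hK).mono_measure (Measure.restrict_mono hQK le_rfl)

theorem exists_mem_localSpace (hP : ∀ φ ∈ P, LocL2 μ φ) (Q : DyadicCube n)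
    {φ : EuclideanSpace ℝ (Fin n) → 𝕜} (hφ : φ ∈ P) :
    ∃ v ∈ localSpace μ P Q.toSet, v =ᵐ[μ] Q.toSet.indicator φ :=
  ⟨(memLp_indicator hP Q hφ).toLp _, ⟨φ, hφ, MemLp.coeFn_toLp _⟩, MemLp.coeFn_toLp _⟩

theorem integrableOn_mul_conj (hP : ∀ φ ∈ P, LocL2 μ φ) (Q : DyadicCube n)
    {φ : EuclideanSpace ℝ (Fin n) → 𝕜} (hφ : φ ∈ P) (f : Lp 𝕜 2 μ) :
    IntegrableOn (fun x => f x * conj (φ x)) Q.toSet μ := by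
  obtain ⟨v, -, hv⟩ := exists_mem_localSpace hP Q hφ
  refine (L2.integrable_inner (𝕜 := 𝕜) v f).integrableOn.congr ?_
  filter_upwards [ae_restrict_of_ae hv, ae_restrict_mem Q.measurableSet_toSet] with x h1 h2
  rw [h1, Set.indicator_of_mem h2, RCLike.inner_apply]

theorem setIntegral_mul_conj {Q : DyadicCube n} {φ : EuclideanSpace ℝ (Fin n) → 𝕜}
    {v : Lp 𝕜 2 μ} (hv : v =ᵐ[μ] Q.toSet.indicator φ) (f : Lp 𝕜 2 μ) :
    ∫ x in Q.toSet, f x * conj (φ x) ∂μ = ⟪v, f⟫_𝕜 := by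
  rw [L2.inner_def, ← integral_indicator Q.measurableSet_toSet]
  refine integral_congr_ae ?_
  filter_upwards [hv] with x h1
  rw [h1, RCLike.inner_apply]
  by_cases hx : x ∈ Q.toSet <;> simp [hx]

/-- Translates the definition into support, restrictions to children and orthogonality in L²(μ), so
that later arguments need neither representatives nor integrals. Local square integrability turns
each φ ∈ `P` into a vector of the local space of Q. -/
theorem mem_alpertSpace_iff (hP : ∀ φ ∈ P, LocL2 μ φ) {Q : DyadicCube n} {f : Lp 𝕜 2 μ} :
    f ∈ alpertSpace μ P Q ↔ cut μ Q.toSet f = f ∧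
      (∀ ε, cut μ (Q.child ε).toSet f ∈ localSpace μ P (Q.child ε).toSet) ∧
      ∀ v ∈ localSpace μ P Q.toSet, ⟪v, f⟫_𝕜 = 0 := by
  have hval : ∀ (p : (Fin n → Bool) → P) (ε : Fin n → Bool) (x : EuclideanSpace ℝ (Fin n)),
      x ∈ (Q.child ε).toSet → (∑ ε', (Q.child ε').toSet.indicator
        (p ε' : EuclideanSpace ℝ (Fin n) → 𝕜)) x = (p ε : EuclideanSpace ℝ (Fin n) → 𝕜) x := by
    intro p ε x hx
    rw [Finset.sum_apply, Finset.sum_eq_single ε, Set.indicator_of_mem hx]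
    · intro ε' _ h
      exact Set.indicator_of_notMem (Set.disjoint_right.1 (Q.disjoint_child h) hx) _
    · simp
  constructor
  · rintro ⟨⟨p, hp⟩, h⟩
    refine ⟨?_, fun ε => ⟨p ε, (p ε).2, ?_⟩, ?_⟩
    · symm
      refine eq_cut_of_ae_eq Q.measurableSet_toSet ?_
      filter_upwards [hp] with x hx
      by_cases hxQ : x ∈ Q.toSet
      · simp [hxQ]
      · rw [Set.indicator_of_notMem hxQ, hx, Finset.sum_apply]
        exact Finset.sum_eq_zero fun ε _ =>
          Set.indicator_of_notMem (fun h => hxQ (Q.child_subset ε h)) _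
    · filter_upwards [cut_coeFn (Q.child ε).measurableSet_toSet f, hp] with x h1 h2
      rw [h1]
      by_cases hx : x ∈ (Q.child ε).toSet
      · rw [Set.indicator_of_mem hx, Set.indicator_of_mem hx, h2, hval p ε x hx]
      · simp [hx]
    · rintro v ⟨φ, hφ, hv⟩
      rw [← setIntegral_mul_conj hv, (h φ hφ).2]
  · rintro ⟨h1, h2, h3⟩
    refine ⟨?_, fun φ hφ => ⟨integrableOn_mul_conj hP Q hφ f, ?_⟩⟩
    · choose p hp hpf using h2
      refine ⟨fun ε => ⟨p ε, hp ε⟩, ?_⟩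
      have hc := cut_coeFn Q.measurableSet_toSet f
      rw [h1] at hc
      filter_upwards [hc, ae_all_iff.2 hpf,
        ae_all_iff.2 fun ε => cut_coeFn (Q.child ε).measurableSet_toSet f] with x h4 h5 h6
      by_cases hx : x ∈ Q.toSet
      · obtain ⟨ε, hε⟩ := DyadicCube.exists_mem_child hx
        refine Eq.trans ?_ (hval (fun ε => ⟨p ε, hp ε⟩) ε x hε).symm
        have h7 := (h6 ε).symm.trans (h5 ε)
        rwa [Set.indicator_of_mem hε, Set.indicator_of_mem hε] at h7
      · rw [h4, Set.indicator_of_notMem hx, Finset.sum_apply]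
        exact (Finset.sum_eq_zero fun ε _ =>
          Set.indicator_of_notMem (fun h => hx (Q.child_subset ε h)) _).symm
    · obtain ⟨v, hv, hvφ⟩ := exists_mem_localSpace hP Q hφ
      rw [setIntegral_mul_conj hvφ, h3 v hv]

variable [FiniteDimensional 𝕜 P]

theorem expProj_mem (S : Set (EuclideanSpace ℝ (Fin n))) (f : Lp 𝕜 2 μ) :
    expProj μ P S f ∈ localSpace μ P S := Submodule.starProjection_apply_mem _ _

theorem alpertProj_mem (Q : DyadicCube n) (f : Lp 𝕜 2 μ) :
    alpertProj μ P Q f ∈ alpertSpace μ P Q := Submodule.starProjection_apply_mem _ _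

theorem inner_expProj {S : Set (EuclideanSpace ℝ (Fin n))} {v : Lp 𝕜 2 μ}
    (hv : v ∈ localSpace μ P S) (f : Lp 𝕜 2 μ) : ⟪v, expProj μ P S f⟫_𝕜 = ⟪v, f⟫_𝕜 := by
  have h := Submodule.sub_starProjection_mem_orthogonal (K := localSpace μ P S) f v hv
  rw [inner_sub_right, sub_eq_zero] at h
  exact h.symm

theorem expProj_eq {S : Set (EuclideanSpace ℝ (Fin n))} {f g : Lp 𝕜 2 μ}
    (hg : g ∈ localSpace μ P S) (h : ∀ v ∈ localSpace μ P S, ⟪v, g⟫_𝕜 = ⟪v, f⟫_𝕜) :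
    expProj μ P S f = g := by
  refine Submodule.eq_starProjection_of_mem_orthogonal hg fun v hv => ?_
  rw [inner_sub_right, h v hv, sub_self]

theorem cut_expProj {S : Set (EuclideanSpace ℝ (Fin n))} (hS : MeasurableSet S) (f : Lp 𝕜 2 μ) :
    cut μ S (expProj μ P S f) = expProj μ P S f :=
  cut_eq_of_mem_localSpace hS (expProj_mem S f)

theorem expProj_cut {S : Set (EuclideanSpace ℝ (Fin n))} (hS : MeasurableSet S) (f : Lp 𝕜 2 μ) :
    expProj μ P S (cut μ S f) = expProj μ P S f :=
  expProj_eq (expProj_mem S f) fun v hv => by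
    rw [inner_expProj hv, ← cut_inner hS, cut_eq_of_mem_localSpace hS hv]

theorem expProj_eq_zero_of_cut {S : Set (EuclideanSpace ℝ (Fin n))} (hS : MeasurableSet S)
    {f : Lp 𝕜 2 μ} (h : cut μ S f = 0) : expProj μ P S f = 0 := by
  rw [← expProj_cut hS, h, map_zero]

theorem cut_alpertProj (hP : ∀ φ ∈ P, LocL2 μ φ) (Q : DyadicCube n) (f : Lp 𝕜 2 μ) :
    cut μ Q.toSet (alpertProj μ P Q f) = alpertProj μ P Q f :=
  ((mem_alpertSpace_iff hP).1 (alpertProj_mem Q f)).1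

theorem cut_child_sum {Q : DyadicCube n} (g : (Fin n → Bool) → Lp 𝕜 2 μ)
    (hg : ∀ ε, cut μ (Q.child ε).toSet (g ε) = g ε) (ε : Fin n → Bool) :
    cut μ (Q.child ε).toSet (∑ ε', g ε') = g ε := by
  rw [map_sum, Finset.sum_eq_single ε, hg]
  · intro ε' _ h
    rw [← hg ε', cut_cut_of_disjoint (DyadicCube.measurableSet_toSet _)
      (DyadicCube.measurableSet_toSet _) (Q.disjoint_child h.symm)]
  · simp

/-- The sum over the children is the projection onto the functions piecewise in `P`, and the Alpert
space is what remains of these after removing the local space of Q. Both parts are checked through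
inner products, with `hin` handling the sum over the children. -/
theorem alpertProj_eq (hP : ∀ φ ∈ P, LocL2 μ φ) (Q : DyadicCube n) (f : Lp 𝕜 2 μ) :
    alpertProj μ P Q f = ∑ ε, expProj μ P (Q.child ε).toSet f - expProj μ P Q.toSet f := by
  have hQ := Q.measurableSet_toSet
  have hc := fun ε => (Q.child ε).measurableSet_toSet
  have hcut : ∀ ε, cut μ (Q.child ε).toSet (∑ ε, expProj μ P (Q.child ε).toSet f) =
      expProj μ P (Q.child ε).toSet f :=
    cut_child_sum _ fun ε => cut_expProj (hc ε) f
  have hin : ∀ v : Lp 𝕜 2 μ, (∀ ε, cut μ (Q.child ε).toSet v ∈ localSpace μ P (Q.child ε).toSet) →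
      ⟪v, ∑ ε, expProj μ P (Q.child ε).toSet f⟫_𝕜 = ⟪cut μ Q.toSet v, f⟫_𝕜 := by
    intro v hv
    rw [← sum_cut_child, inner_sum, sum_inner]
    refine Finset.sum_congr rfl fun ε _ => ?_
    rw [← inner_expProj (hv ε), cut_inner (hc ε), cut_expProj (hc ε)]
  refine Submodule.eq_starProjection_of_mem_orthogonal ?_ ?_
  · rw [mem_alpertSpace_iff hP]
    refine ⟨?_, fun ε => ?_, fun v hv => ?_⟩
    · rw [map_sub, cut_expProj hQ, map_sum]
      congr 1
      exact Finset.sum_congr rfl fun ε _ =>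
        cut_cut_eq (hc ε) hQ (Q.child_subset ε) (cut_expProj (hc ε) f)
    · rw [map_sub, hcut]
      exact Submodule.sub_mem _ (expProj_mem _ f)
        (cut_mem_localSpace (hc ε) (Q.child_subset ε) (expProj_mem _ f))
    · rw [inner_sub_right, inner_expProj hv,
        hin v fun ε => cut_mem_localSpace (hc ε) (Q.child_subset ε) hv,
        cut_eq_of_mem_localSpace hQ hv, sub_self]
  · intro v hv
    obtain ⟨h1, h2, h3⟩ := (mem_alpertSpace_iff hP).1 hv
    rw [inner_sub_right, inner_sub_right, hin v h2, h1,
      inner_eq_zero_symm.1 (h3 _ (expProj_mem Q.toSet f)), sub_zero, sub_self]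

theorem cut_child_alpertProj (hP : ∀ φ ∈ P, LocL2 μ φ) (Q : DyadicCube n) (f : Lp 𝕜 2 μ)
    (ε : Fin n → Bool) :
    cut μ (Q.child ε).toSet (alpertProj μ P Q f) = expProj μ P (Q.child ε).toSet f -
      cut μ (Q.child ε).toSet (expProj μ P Q.toSet f) := by
  rw [alpertProj_eq hP, map_sub, cut_child_sum]
  exact fun ε => cut_expProj (Q.child ε).measurableSet_toSet f

/-! ### Orthogonality -/

/-- If Q lies in S, then 1_Q v is in the local space of Q, to which Alpert functions are orthogonal.
Taking S to be a top or a child of a larger cube covers every orthogonality relation between nested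
sets. -/
theorem inner_alpertProj_eq_zero (hP : ∀ φ ∈ P, LocL2 μ φ) {Q : DyadicCube n}
    {S : Set (EuclideanSpace ℝ (Fin n))} (hS : MeasurableSet S) {v : Lp 𝕜 2 μ}
    (h : Disjoint Q.toSet S ∨ Q.toSet ⊆ S) (hv : v ∈ localSpace μ P S) (f : Lp 𝕜 2 μ) :
    ⟪v, alpertProj μ P Q f⟫_𝕜 = 0 := by
  rcases h with h | h
  · exact inner_eq_zero_of_disjoint hS Q.measurableSet_toSet h.symm
      (cut_eq_of_mem_localSpace hS hv) (cut_alpertProj hP Q f)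
  · rw [← cut_alpertProj hP, ← cut_inner Q.measurableSet_toSet]
    exact ((mem_alpertSpace_iff hP).1 (alpertProj_mem Q f)).2.2 _
      (cut_mem_localSpace Q.measurableSet_toSet h hv)

theorem inner_expProj_expProj_of_disjoint {S S' : Set (EuclideanSpace ℝ (Fin n))}
    (hS : MeasurableSet S) (hS' : MeasurableSet S') (h : Disjoint S S') (f g : Lp 𝕜 2 μ) :
    ⟪expProj μ P S f, expProj μ P S' g⟫_𝕜 = 0 :=
  inner_eq_zero_of_disjoint hS hS' h (cut_expProj hS f) (cut_expProj hS' g)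

theorem inner_alpertProj_alpertProj_of_lt (hP : ∀ φ ∈ P, LocL2 μ φ) {D : DyadicGrid n}
    {Q R : DyadicCube n} (hQ : Q ∈ D.cubes) (hR : R ∈ D.cubes) (h : Q.scale < R.scale)
    (f g : Lp 𝕜 2 μ) : ⟪alpertProj μ P R g, alpertProj μ P Q f⟫_𝕜 = 0 := by
  rcases DyadicGrid.disjoint_or_subset_child hQ hR h with hd | ⟨ε, hε⟩
  · exact inner_eq_zero_of_disjoint R.measurableSet_toSet Q.measurableSet_toSet hd.symm
      (cut_alpertProj hP R g) (cut_alpertProj hP Q f)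
  -- On the child that contains Q, the function of the larger cube is an element of `P`.
  · have hm := (R.child ε).measurableSet_toSet
    rw [← cut_cut_eq Q.measurableSet_toSet hm hε (cut_alpertProj hP Q f), ← cut_inner hm]
    exact inner_alpertProj_eq_zero hP hm (Or.inr hε)
      (((mem_alpertSpace_iff hP).1 (alpertProj_mem R g)).2.1 ε) f

theorem inner_alpertProj_alpertProj (hP : ∀ φ ∈ P, LocL2 μ φ) {D : DyadicGrid n}
    {Q R : DyadicCube n} (hQ : Q ∈ D.cubes) (hR : R ∈ D.cubes) (h : Q ≠ R) (f g : Lp 𝕜 2 μ) :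
    ⟪alpertProj μ P Q f, alpertProj μ P R g⟫_𝕜 = 0 := by
  rcases lt_trichotomy Q.scale R.scale with hlt | heq | hlt
  · exact inner_eq_zero_symm.1 (inner_alpertProj_alpertProj_of_lt hP hQ hR hlt f g)
  · exact inner_eq_zero_of_disjoint Q.measurableSet_toSet R.measurableSet_toSet
      (DyadicGrid.disjoint_of_ne hQ hR heq h) (cut_alpertProj hP Q f) (cut_alpertProj hP R g)
  · exact inner_alpertProj_alpertProj_of_lt hP hR hQ hlt g f

theorem integrable_alpertProj_mul_conj (hP : ∀ φ ∈ P, LocL2 μ φ) (Q : DyadicCube n)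
    {φ : EuclideanSpace ℝ (Fin n) → 𝕜} (hφ : φ ∈ P) (f : Lp 𝕜 2 μ) :
    Integrable (fun x => alpertProj μ P Q f x * conj (φ x)) μ ∧
      ∫ x, alpertProj μ P Q f x * conj (φ x) ∂μ = 0 := by
  have hm := Q.measurableSet_toSet
  obtain ⟨hi, hz⟩ := (alpertProj_mem (P := P) Q f).2 φ hφ
  have hae : Q.toSet.indicator (fun x => alpertProj μ P Q f x * conj (φ x)) =ᵐ[μ]
      fun x => alpertProj μ P Q f x * conj (φ x) := by
    have hc := cut_coeFn hm (alpertProj μ P Q f)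
    rw [cut_alpertProj hP] at hc
    filter_upwards [hc] with x hx
    by_cases hxQ : x ∈ Q.toSet
    · simp [hxQ]
    · rw [hx]; simp [hxQ]
  exact ⟨((integrable_indicator_iff hm).2 hi).congr hae,
    by rw [← integral_congr_ae hae, integral_indicator hm, hz]⟩

/-! ### Density -/

theorem integrableOn_cube [IsLocallyFiniteMeasure μ] (Q : DyadicCube n) (f : Lp 𝕜 2 μ) :
    IntegrableOn f Q.toSet μ := by
  obtain ⟨K, hK, hQK⟩ := Q.exists_isCompact_superset
  have : IsFiniteMeasure (μ.restrict Q.toSet) :=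
    ⟨by rw [Measure.restrict_apply_univ]; exact (measure_mono hQK).trans_lt hK.measure_lt_top⟩
  exact ((Lp.memLp f).restrict Q.toSet).integrable (by norm_num)

/-- A square integrable function with vanishing integral over every cube of the grid vanishes. -/
theorem eq_zero_of_forall_setIntegral_eq_zero [IsLocallyFiniteMeasure μ] (D : DyadicGrid n)
    (f : Lp 𝕜 2 μ) (h : ∀ Q ∈ D.cubes, ∫ x in Q.toSet, f x ∂μ = 0) : f = 0 := by
  have key : ∀ Q ∈ D.cubes, f =ᵐ[μ.restrict Q.toSet] 0 := by
    intro Q hQ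
    have hint := integrableOn_cube Q f
    refine Integrable.ae_eq_zero_of_forall_setIntegral_eq_zero hint ?_
    intro s hs _
    induction s, hs using MeasurableSpace.induction_on_inter D.borel_eq_generateFrom
      D.isPiSystem_cubes with
    | empty => simp
    | basic t ht =>
      obtain ⟨R, hR, rfl⟩ := ht
      rw [Measure.restrict_restrict R.measurableSet_toSet]
      -- By nesting, Q ∩ R is Q, R or empty, so the integral over it vanishes by hypothesis.
      rcases le_total Q.scale R.scale with hs | hs
      · rcases DyadicGrid.disjoint_or_subset hQ hR hs with hd | hd
        · rw [hd.symm.inter_eq]; simp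
        · rw [Set.inter_eq_right.2 hd, h Q hQ]
      · rcases DyadicGrid.disjoint_or_subset hR hQ hs with hd | hd
        · rw [hd.inter_eq]; simp
        · rw [Set.inter_eq_left.2 hd, h R hR]
    | compl t ht ih =>
      have := integral_add_compl (μ := μ.restrict Q.toSet) ht hint
      rw [ih (measure_lt_top_of_subset (Set.subset_univ _) ?_), zero_add, h Q hQ] at this
      · exact this
      · rw [Measure.restrict_apply_univ]
        obtain ⟨K, hK, hQK⟩ := Q.exists_isCompact_superset
        exact ((measure_mono hQK).trans_lt hK.measure_lt_top).ne
    | iUnion g hd hg ih =>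
      rw [integral_iUnion hg hd hint.integrableOn]
      convert tsum_zero with i
      refine ih i (measure_lt_top_of_subset (Set.subset_univ _) ?_)
      rw [Measure.restrict_apply_univ]
      obtain ⟨K, hK, hQK⟩ := Q.exists_isCompact_superset
      exact ((measure_mono hQK).trans_lt hK.measure_lt_top).ne
  apply Lp.ext
  have h2 : ∀ᵐ x ∂μ, ∀ Q : D.cubes, x ∈ Q.1.toSet → f x = 0 := by
    rw [ae_all_iff]
    exact fun Q => (ae_restrict_iff' Q.1.measurableSet_toSet).1 (key Q.1 Q.2)
  filter_upwards [h2, Lp.coeFn_zero 𝕜 2 μ] with x hx hx0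
  rw [hx0, hx ⟨_, D.cubeAt_mem 0 x⟩ (D.mem_cubeAt 0 x), Pi.zero_apply]

omit [FiniteDimensional 𝕜 P] in
theorem eq_zero_of_forall_inner_localSpace_eq_zero [IsLocallyFiniteMeasure μ]
    (hP : ∀ φ ∈ P, LocL2 μ φ) (hone : (fun _ => 1 : EuclideanSpace ℝ (Fin n) → 𝕜) ∈ P)
    (D : DyadicGrid n) (f : Lp 𝕜 2 μ)
    (h : ∀ Q ∈ D.cubes, ∀ v ∈ localSpace μ P Q.toSet, ⟪v, f⟫_𝕜 = 0) : f = 0 := by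
  refine eq_zero_of_forall_setIntegral_eq_zero D f fun Q hQ => ?_
  obtain ⟨v, hv, hvφ⟩ := exists_mem_localSpace hP Q hone
  rw [← h Q hQ v hv, ← setIntegral_mul_conj hvφ]
  simp

end Projections

/-! ### Limits along increasing sets, and norm versus almost everywhere convergence. -/

section CutLimits

variable {𝕜 : Type*} [RCLike 𝕜] {α : Type*} [MeasurableSpace α] {μ : Measure α}

theorem norm_cut_sq {S : Set α} (hS : MeasurableSet S) (f : Lp 𝕜 2 μ) :
    ‖cut μ S f‖ ^ 2 = ∫ x in S, ‖f x‖ ^ 2 ∂μ := by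
  have h : ((‖cut μ S f‖ ^ 2 : ℝ) : 𝕜) = ((∫ x in S, ‖f x‖ ^ 2 ∂μ : ℝ) : 𝕜) := by
    rw [← integral_ofReal, ← integral_indicator hS]
    push_cast
    rw [← inner_self_eq_norm_sq_to_K (𝕜 := 𝕜), L2.inner_def]
    refine integral_congr_ae ?_
    filter_upwards [cut_coeFn hS f] with x hx
    rw [hx]
    by_cases hxS : x ∈ S
    · simp only [hxS, Set.indicator_of_mem, inner_self_eq_norm_sq_to_K]
    · simp only [hxS, Set.indicator_of_notMem, not_false_eq_true, inner_zero_left]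
  exact_mod_cast h

theorem integrable_norm_sq (f : Lp 𝕜 2 μ) : Integrable (fun x => ‖f x‖ ^ 2) μ :=
  (memLp_two_iff_integrable_sq_norm (Lp.memLp f).1).1 (Lp.memLp f)

/-- By Pythagoras the squared error is a difference of integrals of |f|² over the union and over
S_m, and the latter converge by monotonicity. -/
theorem tendsto_cut_iUnion {S : ℕ → Set α} (hS : ∀ m, MeasurableSet (S m)) (hmono : Monotone S)
    (f : Lp 𝕜 2 μ) : Tendsto (fun m => cut μ (S m) f) atTop (𝓝 (cut μ (⋃ m, S m) f)) := by
  have hT : MeasurableSet (⋃ m, S m) := MeasurableSet.iUnion hS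
  have h1 := tendsto_setIntegral_of_monotone hS hmono (integrable_norm_sq f).integrableOn
  simp_rw [← norm_cut_sq (hS _), ← norm_cut_sq hT] at h1
  have h2 : ∀ m, ‖cut μ (⋃ m, S m) f - cut μ (S m) f‖ ^ 2 =
      ‖cut μ (⋃ m, S m) f‖ ^ 2 - ‖cut μ (S m) f‖ ^ 2 := by
    intro m
    have hd : Disjoint (S m) ((⋃ m, S m) \ S m) := Set.disjoint_sdiff_right
    have hu : S m ∪ (⋃ m, S m) \ S m = ⋃ m, S m :=
      Set.union_sdiff_cancel (Set.subset_iUnion S m)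
    have h3 := cut_union (hS m) (hT.diff (hS m)) hd f
    have h4 := norm_cut_union_sq (hS m) (hT.diff (hS m)) hd f
    rw [hu] at h3 h4
    rw [h4, h3, add_sub_cancel_left, add_sub_cancel_left]
  rw [tendsto_iff_norm_sub_tendsto_zero]
  have h5 : Tendsto (fun m => √(‖cut μ (⋃ m, S m) f‖ ^ 2 - ‖cut μ (S m) f‖ ^ 2)) atTop (𝓝 0) := by
    have := (tendsto_const_nhds (x := ‖cut μ (⋃ m, S m) f‖ ^ 2)).sub h1
    rw [sub_self] at this
    simpa using this.sqrt
  refine h5.congr fun m => ?_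
  rw [← h2, Real.sqrt_sq (norm_nonneg _), norm_sub_rev]

/-- In a finite-dimensional subspace of `L²(μ)` convergence in norm implies convergence almost
everywhere. -/
theorem ae_tendsto_of_finiteDimensional (K : Submodule 𝕜 (Lp 𝕜 2 μ)) [FiniteDimensional 𝕜 K]
    {u : ℕ → Lp 𝕜 2 μ} {e : Lp 𝕜 2 μ} (hu : ∀ m, u m ∈ K) (h : Tendsto u atTop (𝓝 e)) :
    ∀ᵐ x ∂μ, Tendsto (fun m => u m x) atTop (𝓝 (e x)) := by
  have he : e ∈ K := K.closed_of_finiteDimensional.mem_of_tendsto h (Eventually.of_forall hu)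
  let b := Module.finBasis 𝕜 K
  have hrep : ∀ w : K, ∀ᵐ x ∂μ,
      (w : Lp 𝕜 2 μ) x = ∑ i, b.equivFunL w i * (b i : Lp 𝕜 2 μ) x := by
    intro w
    have hw : (w : Lp 𝕜 2 μ) = ∑ i, b.equivFunL w i • (b i : Lp 𝕜 2 μ) := by
      have h := congrArg K.subtype (b.sum_equivFun w)
      rw [map_sum] at h
      exact h.symm
    have h2 : ∀ᵐ x ∂μ, ∀ i, (b.equivFunL w i • (b i : Lp 𝕜 2 μ)) x =
        b.equivFunL w i * (b i : Lp 𝕜 2 μ) x := by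
      rw [ae_all_iff]
      intro i
      filter_upwards [Lp.coeFn_smul (b.equivFunL w i) (b i : Lp 𝕜 2 μ)] with x hx
      rw [hx, Pi.smul_apply, smul_eq_mul]
    filter_upwards [h2, Lp.coeFn_finsetSum Finset.univ
      fun i => b.equivFunL w i • (b i : Lp 𝕜 2 μ)] with x h3 h4
    rw [← hw] at h4
    rw [h4, Finset.sum_apply]
    exact Finset.sum_congr rfl fun i _ => h3 i
  have hK : Tendsto (fun m => (⟨u m, hu m⟩ : K)) atTop (𝓝 ⟨e, he⟩) := tendsto_subtype_rng.2 h
  have hc : ∀ i, Tendsto (fun m => b.equivFunL ⟨u m, hu m⟩ i) atTop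
      (𝓝 (b.equivFunL ⟨e, he⟩ i)) := fun i =>
    ((continuous_apply i).comp b.equivFunL.continuous).continuousAt.tendsto.comp hK
  filter_upwards [ae_all_iff.2 fun m => hrep ⟨u m, hu m⟩, hrep ⟨e, he⟩] with x h1 h2
  simp_rw [h1, h2]
  exact tendsto_finsetSum _ fun i _ => (hc i).mul_const _

end CutLimits

/-! ### Limits of the projections over growing cubes. -/

section LargeScale

variable {𝕜 : Type*} [RCLike 𝕜] {n : ℕ} {μ : Measure (EuclideanSpace ℝ (Fin n))}
  {P : Submodule 𝕜 (EuclideanSpace ℝ (Fin n) → 𝕜)} [FiniteDimensional 𝕜 P]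
  {S : ℕ → Set (EuclideanSpace ℝ (Fin n))}

/-- On each S_m the function u agrees with some φ_m ∈ `P`, possibly a different one for each m. The
subspaces N_m of elements of `P` that vanish a.e. on S_m decrease, hence are constant from some m₀
on. For m ≥ m₀ the difference φ_m − φ_{m₀} is in N_{m₀} = N_m, so φ_{m₀} serves on the whole union.
-/
theorem mem_localSpace_iUnion (hS : ∀ m, MeasurableSet (S m)) (hmono : Monotone S)
    {u : Lp 𝕜 2 μ} (h0 : cut μ (⋃ m, S m) u = u)
    (hu : ∀ m, cut μ (S m) u ∈ localSpace μ P (S m)) : u ∈ localSpace μ P (⋃ m, S m) := by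
  let N : ℕ → Submodule 𝕜 P := fun m =>
    { carrier := {φ | ∀ᵐ x ∂μ, x ∈ S m → (φ : EuclideanSpace ℝ (Fin n) → 𝕜) x = 0}
      zero_mem' := by simp
      add_mem' := by
        intro φ ψ h1 h2
        change ∀ᵐ x ∂μ, _
        filter_upwards [h1, h2] with x h3 h4 hx
        simp [h3 hx, h4 hx]
      smul_mem' := by
        intro c φ h1
        change ∀ᵐ x ∂μ, _
        filter_upwards [h1] with x h3 hx
        simp [h3 hx] }
  obtain ⟨m₀, hm₀⟩ := IsArtinian.monotone_stabilizes (R := 𝕜) (M := P)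
    ⟨fun m => OrderDual.toDual (N m), fun i j hij φ hφ => by
      change ∀ᵐ x ∂μ, x ∈ S j → (φ : EuclideanSpace ℝ (Fin n) → 𝕜) x = 0 at hφ
      change ∀ᵐ x ∂μ, x ∈ S i → (φ : EuclideanSpace ℝ (Fin n) → 𝕜) x = 0
      filter_upwards [hφ] with x hx hxi using hx (hmono hij hxi)⟩
  choose φ hφ hφu using hu
  have hval : ∀ᵐ x ∂μ, ∀ m, x ∈ S m → u x = φ m x := by
    rw [ae_all_iff]
    intro m
    filter_upwards [hφu m, cut_coeFn (hS m) u] with x h1 h2 hx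
    rw [h1, Set.indicator_of_mem hx, Set.indicator_of_mem hx] at h2
    exact h2.symm
  have hstab : ∀ᵐ x ∂μ, ∀ m, m₀ ≤ m → x ∈ S m → φ m x = φ m₀ x := by
    simp_rw [ae_all_iff]
    intro m hm
    have h1 : (⟨φ m, hφ m⟩ - ⟨φ m₀, hφ m₀⟩ : P) ∈ N m₀ := by
      filter_upwards [hval] with x hx hxm
      simp [← hx m₀ hxm, ← hx m (hmono hm hxm)]
    have h2 : N m₀ = N m := hm₀ m hm
    rw [h2] at h1
    filter_upwards [h1] with x hx hxm
    simpa [sub_eq_zero] using hx hxm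
  refine ⟨φ m₀, hφ m₀, ?_⟩
  have hc := cut_coeFn (MeasurableSet.iUnion hS) u
  rw [h0] at hc
  filter_upwards [hc, hval, hstab] with x h1 h2 h3
  by_cases hx : x ∈ ⋃ m, S m
  · obtain ⟨m, hm⟩ := Set.mem_iUnion.1 hx
    have hm' := hmono (le_max_left m m₀) hm
    rw [Set.indicator_of_mem hx, h2 _ hm', h3 _ (le_max_right _ _) hm']
  · rw [h1, Set.indicator_of_notMem hx, Set.indicator_of_notMem hx]

/-- The projections onto the local spaces of an increasing sequence of sets converge strongly to
the projection onto the local space of the union. -/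
theorem tendsto_expProj_iUnion (hS : ∀ m, MeasurableSet (S m)) (hmono : Monotone S)
    (f : Lp 𝕜 2 μ) :
    Tendsto (fun m => expProj μ P (S m) f) atTop (𝓝 (expProj μ P (⋃ m, S m) f)) := by
  have hT : MeasurableSet (⋃ m, S m) := MeasurableSet.iUnion hS
  -- The local spaces themselves need not be monotone in m. Their complements in L²(S_m) are: a
  -- function supported in S_i and orthogonal to `P` there keeps this property on larger sets.
  let U : ℕ → Submodule 𝕜 (Lp 𝕜 2 μ) := fun m =>
    (ContinuousLinearMap.id 𝕜 (Lp 𝕜 2 μ) - cut μ (S m)).ker ⊓ (localSpace μ P (S m))ᗮ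
  have hmem : ∀ m u, u ∈ U m ↔ cut μ (S m) u = u ∧
      ∀ v ∈ localSpace μ P (S m), ⟪v, u⟫_𝕜 = 0 := by
    intro m u
    simp only [U, Submodule.mem_inf, LinearMap.mem_ker, Submodule.mem_orthogonal]
    refine and_congr ?_ Iff.rfl
    change u - cut μ (S m) u = 0 ↔ _
    rw [sub_eq_zero, eq_comm]
  have hclosed : ∀ m, IsClosed (U m : Set (Lp 𝕜 2 μ)) := fun m =>
    (ContinuousLinearMap.isClosed_ker _).inter (Submodule.isClosed_orthogonal _)
  have hcomplete : ∀ m, CompleteSpace (U m) := fun m => (hclosed m).completeSpace_coe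
  have hU : Monotone U := by
    intro i j hij u hu
    rw [hmem] at hu ⊢
    refine ⟨cut_cut_eq (hS i) (hS j) (hmono hij) hu.1, fun v hv => ?_⟩
    rw [← hu.1, ← cut_inner (hS i)]
    exact hu.2 _ (cut_mem_localSpace (hS i) (hmono hij) hv)
  have hproj : ∀ m, (U m).starProjection f = cut μ (S m) f - expProj μ P (S m) f := by
    intro m
    refine Submodule.eq_starProjection_of_mem_orthogonal ?_ fun u hu => ?_
    · rw [hmem]
      refine ⟨by rw [map_sub, cut_self (hS m), cut_expProj (hS m)], fun v hv => ?_⟩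
      rw [inner_sub_right, inner_expProj hv, ← cut_inner (hS m),
        cut_eq_of_mem_localSpace (hS m) hv, sub_self]
    · rw [hmem] at hu
      rw [inner_sub_right, inner_sub_right, ← cut_inner (hS m), hu.1,
        inner_eq_zero_symm.1 (hu.2 _ (expProj_mem (S m) f)), sub_zero, sub_self]
  have h1 := Submodule.starProjection_tendsto_closure_iSup U hU f
  set v := (⨆ i, U i).topologicalClosure.starProjection f
  have h2 := (tendsto_cut_iUnion hS hmono f).sub h1
  simp_rw [hproj, sub_sub_cancel] at h2
  convert h2 using 2
  -- The limit exists by now; it is identified by membership in the local space of the union and by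
  -- its inner products with that space.
  refine expProj_eq ?_ fun w hw => ?_
  · refine mem_localSpace_iUnion hS hmono ?_ fun m => ?_
    · refine tendsto_nhds_unique (((cut μ (⋃ m, S m)).continuous.tendsto _).comp h2) ?_
      refine h2.congr fun m => ?_
      rw [Function.comp_apply,
        cut_cut_eq (hS m) hT (Set.subset_iUnion S m) (cut_expProj (hS m) f)]
    · refine (localSpace μ P (S m)).closed_of_finiteDimensional.mem_of_tendsto
        (((cut μ (S m)).continuous.tendsto _).comp h2) ?_
      filter_upwards [eventually_ge_atTop m] with j hj
      exact cut_mem_localSpace (hS m) (hmono hj) (expProj_mem (S j) f)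
  · refine tendsto_nhds_unique (((continuous_const (y := w)).inner continuous_id).tendsto _ |>.comp
      h2) ?_
    have h3 : ∀ m, ⟪w, expProj μ P (S m) f⟫_𝕜 = ⟪cut μ (S m) w, f⟫_𝕜 := by
      intro m
      rw [← inner_expProj (cut_mem_localSpace (hS m) (Set.subset_iUnion S m) hw),
        cut_inner (hS m), cut_expProj (hS m)]
    have h4 := (((continuous_id.inner (continuous_const (y := f))).tendsto _).comp
      (tendsto_cut_iUnion hS hmono w) :
        Tendsto (fun m => ⟪cut μ (S m) w, f⟫_𝕜) atTop (𝓝 ⟪cut μ (⋃ m, S m) w, f⟫_𝕜))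
    rw [cut_eq_of_mem_localSpace hT hw] at h4
    exact h4.congr fun m => (h3 m).symm

/-- Cut down to a fixed S_j, all terms with m ≥ j lie in the finite-dimensional local space of S_j,
where norm convergence gives convergence almost everywhere. Countably many j exhaust the union. -/
theorem ae_tendsto_expProj_iUnion (hS : ∀ m, MeasurableSet (S m)) (hmono : Monotone S)
    (f : Lp 𝕜 2 μ) :
    ∀ᵐ x ∂μ, x ∈ ⋃ m, S m →
      Tendsto (fun m => expProj μ P (S m) f x) atTop (𝓝 (expProj μ P (⋃ m, S m) f x)) := by
  have h : ∀ j, ∀ᵐ x ∂μ, x ∈ S j →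
      Tendsto (fun m => expProj μ P (S m) f x) atTop (𝓝 (expProj μ P (⋃ m, S m) f x)) := by
    intro j
    have h1 := (tendsto_add_atTop_iff_nat j).2
      (((cut μ (S j)).continuous.tendsto _).comp (tendsto_expProj_iUnion (P := P) hS hmono f))
    have h2 := ae_tendsto_of_finiteDimensional (localSpace μ P (S j))
      (fun m => cut_mem_localSpace (hS j) (hmono (Nat.le_add_left j m)) (expProj_mem _ f)) h1
    filter_upwards [h2, cut_coeFn (hS j) (expProj μ P (⋃ m, S m) f),
      ae_all_iff.2 fun m => cut_coeFn (hS j) (expProj μ P (S m) f)] with x h3 h4 h5 hx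
    simp_rw [h4, h5, Set.indicator_of_mem hx] at h3
    exact (tendsto_add_atTop_iff_nat j).1 h3
  filter_upwards [ae_all_iff.2 h] with x hx hxS
  obtain ⟨j, hj⟩ := Set.mem_iUnion.1 hxS
  exact hx j hj

theorem iUnion_cubeAt_natCast (D : DyadicGrid n) (x : EuclideanSpace ℝ (Fin n)) :
    ⋃ m : ℕ, (D.cubeAt m x).toSet = D.topAt x := by
  refine (Set.iUnion_subset fun m => DyadicGrid.cubeAt_subset_topAt _ x).antisymm ?_
  refine Set.iUnion_subset fun m => ?_
  exact_mod_cast Set.subset_iUnion (fun m : ℕ => (D.cubeAt m x).toSet) (m + 1)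

/-- The projections onto the local spaces of the cubes that contain a point converge to the
projection onto the local space of the top, almost everywhere. -/
theorem ae_tendsto_expProj_atTop (D : DyadicGrid n) (f : Lp 𝕜 2 μ) :
    ∀ᵐ x ∂μ, Tendsto (fun k : ℤ => expProj μ P (D.cubeAt k x).toSet f x) atTop
      (𝓝 (expProj μ P (D.topAt x) f x)) := by
  have h : ∀ T ∈ D.tops, ∀ᵐ x ∂μ, x ∈ T → Tendsto
      (fun k : ℤ => expProj μ P (D.cubeAt k x).toSet f x) atTop (𝓝 (expProj μ P T f x)) := by
    intro T hT
    obtain ⟨y, rfl⟩ := DyadicGrid.exists_eq_topAt hT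
    have h1 := ae_tendsto_expProj_iUnion (μ := μ) (P := P)
      (S := fun m : ℕ => (D.cubeAt m y).toSet) (fun m => DyadicCube.measurableSet_toSet _)
      (fun i j hij => DyadicGrid.cubeAt_mono (by exact_mod_cast hij) y) f
    rw [iUnion_cubeAt_natCast] at h1
    filter_upwards [h1] with x hx hxT
    rw [← Nat.map_cast_int_atTop, tendsto_map'_iff]
    -- A point of the top of y shares all cubes with y from some scale on, so the single chain
    -- through y decides the limit.
    refine (hx hxT).congr' ?_
    rw [← iUnion_cubeAt_natCast] at hxT
    obtain ⟨j, hj⟩ := Set.mem_iUnion.1 hxT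
    filter_upwards [eventually_ge_atTop j] with m hm
    rw [Function.comp_apply, DyadicGrid.cubeAt_eq_cubeAt (by exact_mod_cast hm) hj]
  filter_upwards [(ae_ball_iff D.finite_tops.countable).2 h] with x hx
  exact hx _ (DyadicGrid.topAt_mem_tops x) (DyadicGrid.mem_topAt x)

end LargeScale

/-! ### Recovering a vector from finitely many resolvents. -/

section Resolvents

/-- The values at `0` of the Lagrange basis polynomials of the nodes `1, …, d`, multiplied by
bounds for determinants, and added up. -/
noncomputable def resolventConst (d : ℕ) : ℝ :=
  ∑ i : Fin d, |(Lagrange.basis Finset.univ (fun i : Fin d => (i : ℝ) + 1) i).eval 0| *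
    (1 + ((i : ℝ) + 1)) ^ d

/-- The product is a polynomial in the node i + 1, of degree at most m − 1 < d and with value 1 at
0; the sum is its Lagrange interpolant evaluated at 0. -/
theorem sum_lagrange_eval_zero {d m : ℕ} (h : m ≤ d) (l : Fin m → ℝ) (j : Fin m) :
    ∑ i : Fin d, (Lagrange.basis Finset.univ (fun i : Fin d => (i : ℝ) + 1) i).eval 0 *
      ∏ k ∈ Finset.univ.erase j, (1 + ((i : ℝ) + 1) * l k) = 1 := by
  let p : Polynomial ℝ := ∏ k ∈ Finset.univ.erase j, (1 + Polynomial.C (l k) * Polynomial.X)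
  have hdeg : p.degree < (Finset.univ : Finset (Fin d)).card := by
    have h1 : p.natDegree ≤ ∑ k ∈ Finset.univ.erase j, 1 := by
      refine (Polynomial.natDegree_prod_le _ _).trans (Finset.sum_le_sum fun k _ => ?_)
      refine (Polynomial.natDegree_add_le _ _).trans ?_
      simp only [Polynomial.natDegree_one, zero_le, sup_of_le_right]
      exact (Polynomial.natDegree_C_mul_le _ _).trans Polynomial.natDegree_X_le
    rw [Finset.sum_const, Finset.card_erase_of_mem (Finset.mem_univ j), Finset.card_fin,
      smul_eq_mul, mul_one] at h1
    refine Polynomial.degree_le_natDegree.trans_lt ?_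
    rw [Finset.card_fin]
    have := j.pos
    exact_mod_cast (by omega : p.natDegree < d)
  have hinj : Set.InjOn (fun i : Fin d => (i : ℝ) + 1) (Finset.univ : Finset (Fin d)) := by
    intro a _ b _ hab
    simp only [add_left_inj, Nat.cast_inj] at hab
    exact Fin.ext hab
  have h2 := congrArg (Polynomial.eval 0) (Lagrange.eq_interpolate hinj hdeg)
  rw [Lagrange.interpolate_apply, Polynomial.eval_finsetSum] at h2
  have h3 : p.eval 0 = 1 := by simp [p, Polynomial.eval_prod]
  rw [h3] at h2
  refine Eq.trans (Finset.sum_congr rfl fun i _ => ?_) h2.symm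
  rw [Polynomial.eval_mul, Polynomial.eval_C, mul_comm]
  simp only [p, Polynomial.eval_prod, Polynomial.eval_add, Polynomial.eval_one,
    Polynomial.eval_mul, Polynomial.eval_C, Polynomial.eval_X]
  congr 1
  exact Finset.prod_congr rfl fun k _ => by rw [mul_comm]

/-- Every vector `x` is a combination of the vectors `(1 + s T)⁻¹ x`, `s = 1, …, d`, with
coefficients bounded in terms of the dimension, when `0 ≤ T ≤ 1`. -/
theorem exists_resolvent_combination {𝕜 V : Type*} [RCLike 𝕜] [NormedAddCommGroup V]
    [InnerProductSpace 𝕜 V] [FiniteDimensional 𝕜 V] {d : ℕ} (hd : Module.finrank 𝕜 V ≤ d)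
    {T : V →ₗ[𝕜] V} (hT : T.IsSymmetric)
    (hT0 : ∀ v, 0 ≤ RCLike.re ⟪v, T v⟫_𝕜) (hT1 : ∀ v, RCLike.re ⟪v, T v⟫_𝕜 ≤ ‖v‖ ^ 2) (x : V) :
    ∃ (y : Fin d → V) (c : Fin d → 𝕜), (∀ i, ‖c i‖ ≤ resolventConst d) ∧
      x = ∑ i, c i • y i ∧ ∀ i : Fin d, y i + (((i : ℝ) + 1 : ℝ) : 𝕜) • T (y i) = x := by
  let b := hT.eigenvectorBasis rfl
  let l := hT.eigenvalues rfl
  have hb : ∀ j, T (b j) = (l j : 𝕜) • b j := hT.apply_eigenvectorBasis rfl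
  have hre : ∀ j, RCLike.re ⟪b j, T (b j)⟫_𝕜 = l j := by
    intro j
    rw [hb, inner_smul_right, inner_self_eq_norm_sq_to_K, b.norm_eq_one]
    simp
  have hl0 : ∀ j, 0 ≤ l j := fun j => hre j ▸ hT0 (b j)
  have hl1 : ∀ j, l j ≤ 1 := fun j => by
    have := hT1 (b j)
    rwa [hre, b.norm_eq_one, one_pow] at this
  let s : Fin d → ℝ := fun i => (i : ℝ) + 1
  have hs : ∀ i, 0 < s i := fun i => by positivity
  have hpos : ∀ i j, 0 < 1 + s i * l j := fun i j => by
    have := mul_nonneg (hs i).le (hl0 j)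
    linarith
  have hne : ∀ i j, ((1 + s i * l j : ℝ) : 𝕜) ≠ 0 := fun i j => by
    exact_mod_cast (hpos i j).ne'
  let L : Fin d → ℝ := fun i =>
    (Lagrange.basis Finset.univ (fun i : Fin d => (i : ℝ) + 1) i).eval 0
  -- In the eigenbasis the resolvent divides the j-th coordinate by 1 + s_i l_j. The coefficient
  -- L_i(0) det(1 + s_i T) cancels this factor and leaves the product over k ≠ j, so the same
  -- coefficients work for every j.
  refine ⟨fun i => ∑ j, (((1 + s i * l j : ℝ) : 𝕜)⁻¹ * b.repr x j) • b j,
    fun i => ((L i * ∏ k, (1 + s i * l k) : ℝ) : 𝕜), fun i => ?_, ?_, fun i => ?_⟩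
  · rw [RCLike.norm_ofReal, abs_mul]
    refine le_trans ?_ (Finset.single_le_sum (f := fun i : Fin d => |L i| * (1 + s i) ^ d)
      (fun i _ => by have := hs i; positivity) (Finset.mem_univ i))
    refine mul_le_mul_of_nonneg_left ?_ (abs_nonneg _)
    rw [Finset.abs_prod]
    calc ∏ k, |1 + s i * l k| ≤ ∏ _k : Fin (Module.finrank 𝕜 V), (1 + s i) := by
          refine Finset.prod_le_prod (fun _ _ => abs_nonneg _) fun k _ => ?_
          rw [abs_of_pos (hpos i k)]
          have := mul_le_mul_of_nonneg_left (hl1 k) (hs i).le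
          linarith
      _ = (1 + s i) ^ Module.finrank 𝕜 V := by simp
      _ ≤ (1 + s i) ^ d := pow_le_pow_right₀ (by linarith [hs i]) hd
  · simp_rw [Finset.smul_sum]
    rw [Finset.sum_comm]
    conv_lhs => rw [← b.sum_repr x]
    refine Finset.sum_congr rfl fun j _ => ?_
    simp_rw [smul_smul, ← Finset.sum_smul]
    congr 1
    have h1 : ∀ i, ((L i * ∏ k, (1 + s i * l k) : ℝ) : 𝕜) *
        ((((1 + s i * l j : ℝ) : 𝕜))⁻¹ * b.repr x j) =
        ((L i * ∏ k ∈ Finset.univ.erase j, (1 + s i * l k) : ℝ) : 𝕜) * b.repr x j := by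
      intro i
      rw [← Finset.mul_prod_erase _ _ (Finset.mem_univ j), mul_left_comm (L i),
        RCLike.ofReal_mul (1 + s i * l j)]
      rw [mul_assoc, mul_left_comm, mul_inv_cancel_left₀ (hne i j)]
    simp_rw [h1, ← Finset.sum_mul, ← RCLike.ofReal_sum]
    have h2 := sum_lagrange_eval_zero hd l j
    simp only [L, s]
    rw [h2]
    simp
  · simp_rw [map_sum, map_smul, hb, Finset.smul_sum, ← Finset.sum_add_distrib, smul_smul, ← add_smul]
    conv_rhs => rw [← b.sum_repr x]
    refine Finset.sum_congr rfl fun j _ => ?_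
    congr 1
    have h1 := hne i j
    have h2 : ((1 + s i * l j : ℝ) : 𝕜) = 1 + (s i : 𝕜) * (l j : 𝕜) := by push_cast; ring
    have h3 : (((i : ℝ) + 1 : ℝ) : 𝕜) = (s i : 𝕜) := rfl
    rw [h3]
    rw [h2] at h1 ⊢
    field_simp

end Resolvents

/-! ### Reweighted projections and the energy estimate on the tree. -/

section Energy

variable {𝕜 : Type*} [RCLike 𝕜] {n : ℕ} {μ : Measure (EuclideanSpace ℝ (Fin n))}
  {P : Submodule 𝕜 (EuclideanSpace ℝ (Fin n) → 𝕜)}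

/-- Makes the number of resolvents and the bound on the coefficients the same for all cubes. -/
theorem finrank_localSpace_le [FiniteDimensional 𝕜 P] (hP : ∀ φ ∈ P, LocL2 μ φ)
    (Q : DyadicCube n) : Module.finrank 𝕜 (localSpace μ P Q.toSet) ≤ Module.finrank 𝕜 P := by
  let L : P →ₗ[𝕜] Lp 𝕜 2 μ :=
    { toFun := fun φ => (memLp_indicator hP Q φ.2).toLp _
      map_add' := fun φ ψ => by
        rw [← MemLp.toLp_add]
        exact MemLp.toLp_congr _ _ (Eventually.of_forall fun x => by
          rw [Submodule.coe_add, Set.indicator_add'])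
      map_smul' := fun c φ => by
        rw [RingHom.id_apply, ← MemLp.toLp_const_smul]
        exact MemLp.toLp_congr _ _ (Eventually.of_forall fun x => by
          rw [Submodule.coe_smul]
          exact congrFun (Set.indicator_const_smul Q.toSet c _) x) }
  have hle : localSpace μ P Q.toSet ≤ L.range := by
    rintro f ⟨φ, hφ, hf⟩
    refine ⟨⟨φ, hφ⟩, Lp.ext ?_⟩
    exact (MemLp.coeFn_toLp (memLp_indicator hP Q hφ)).trans hf.symm
  exact (Submodule.finrank_mono hle).trans L.finrank_range_le

/-- `y` is the projection of `f / w` onto the local space of `Q` with respect to the measure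
`w dμ`, where `w = 1 + s 1_S`. -/
def IsReweightedProj (μ : Measure (EuclideanSpace ℝ (Fin n)))
    (P : Submodule 𝕜 (EuclideanSpace ℝ (Fin n) → 𝕜)) (s : ℝ) (S : Set (EuclideanSpace ℝ (Fin n)))
    (Q : DyadicCube n) (f y : Lp 𝕜 2 μ) : Prop :=
  y ∈ localSpace μ P Q.toSet ∧
    ∀ v ∈ localSpace μ P Q.toSet, ⟪v, y⟫_𝕜 + (s : 𝕜) * ⟪v, cut μ S y⟫_𝕜 = ⟪v, f⟫_𝕜

/-- The functional that is maximized by the reweighted projection. -/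
noncomputable def energy (s : ℝ) (S : Set (EuclideanSpace ℝ (Fin n))) (f v : Lp 𝕜 2 μ) : ℝ :=
  2 * RCLike.re ⟪v, f⟫_𝕜 - ‖v‖ ^ 2 - s * ‖cut μ S v‖ ^ 2

/-- Completing the square: the two energies differ by ‖v − y‖² + s ‖1_S (v − y)‖². -/
theorem energy_le {s : ℝ} (hs : 0 ≤ s) {S : Set (EuclideanSpace ℝ (Fin n))}
    (hS : MeasurableSet S) {Q : DyadicCube n} {f y v : Lp 𝕜 2 μ}
    (hy : IsReweightedProj μ P s S Q f y) (hv : v ∈ localSpace μ P Q.toSet) :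
    energy s S f v ≤ energy s S f y := by
  have h1 := congrArg RCLike.re (hy.2 v hv)
  have h2 := congrArg RCLike.re (hy.2 y hy.1)
  rw [map_add, RCLike.re_ofReal_mul, ← cut_self_inner hS] at h1 h2
  rw [inner_self_eq_norm_sq, inner_self_eq_norm_sq] at h2
  have h3 := norm_sub_sq (𝕜 := 𝕜) v y
  have h4 := norm_sub_sq (𝕜 := 𝕜) (cut μ S v) (cut μ S y)
  have h5 := mul_nonneg hs (sq_nonneg ‖cut μ S v - cut μ S y‖)
  rw [h4] at h5
  have h6 := sq_nonneg ‖v - y‖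
  rw [h3] at h6
  unfold energy
  rw [← h1, ← h2]
  linarith

/-- Take T to be the compression of multiplication by 1_S to the local space, so that 0 ≤ T ≤ 1. The
equation (1 + sT) y = E_Q f, tested against the local space, is exactly the one that defines a
reweighted projection. -/
theorem exists_isReweightedProj_combination [FiniteDimensional 𝕜 P] (hP : ∀ φ ∈ P, LocL2 μ φ)
    {S : Set (EuclideanSpace ℝ (Fin n))} (hS : MeasurableSet S) (Q : DyadicCube n)
    (f : Lp 𝕜 2 μ) :
    ∃ (y : Fin (Module.finrank 𝕜 P) → Lp 𝕜 2 μ) (c : Fin (Module.finrank 𝕜 P) → 𝕜),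
      (∀ i, ‖c i‖ ≤ resolventConst (Module.finrank 𝕜 P)) ∧
      expProj μ P Q.toSet f = ∑ i, c i • y i ∧
      ∀ i : Fin (Module.finrank 𝕜 P), IsReweightedProj μ P ((i : ℝ) + 1) S Q f (y i) := by
  let K := localSpace μ P Q.toSet
  let T : K →ₗ[𝕜] K := K.orthogonalProjectionOnto.toLinearMap ∘ₗ
    (cut μ S).toLinearMap ∘ₗ K.subtype
  have hinner : ∀ u v : K, ⟪u, T v⟫_𝕜 = ⟪(u : Lp 𝕜 2 μ), cut μ S v⟫_𝕜 := fun u v =>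
    Submodule.inner_orthogonalProjectionOnto_eq_of_mem_left u (cut μ S (v : Lp 𝕜 2 μ))
  have hsq : ∀ v : K, RCLike.re ⟪v, T v⟫_𝕜 = ‖cut μ S (v : Lp 𝕜 2 μ)‖ ^ 2 := fun v => by
    rw [hinner, ← cut_self_inner hS, inner_self_eq_norm_sq]
  have hT : T.IsSymmetric := fun u v => by
    rw [hinner, ← inner_conj_symm, hinner, inner_conj_symm, cut_inner hS]
  obtain ⟨y, c, hc, hx, hy⟩ := exists_resolvent_combination (finrank_localSpace_le hP Q) hT
    (fun v => by rw [hsq]; positivity)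
    (fun v => by
      rw [hsq]
      exact pow_le_pow_left₀ (norm_nonneg _) (norm_cut_le _) 2)
    ⟨expProj μ P Q.toSet f, expProj_mem _ f⟩
  refine ⟨fun i => y i, c, hc, ?_, fun i => ⟨(y i).2, fun v hv => ?_⟩⟩
  · have := congrArg K.subtype hx
    rw [map_sum] at this
    exact this
  · have h1 := congrArg (fun z : K => ⟪(⟨v, hv⟩ : K), z⟫_𝕜) (hy i)
    simp only [inner_add_right, inner_smul_right, hinner] at h1
    exact h1.trans (inner_expProj hv f)

/-- The sum of `‖1_{E_R} y_R‖²` over `Q` and its descendants `R` of less than `N` generations,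
where `E_R` depends on the scale of `R` only. -/
noncomputable def treeSum (E : ℤ → Set (EuclideanSpace ℝ (Fin n)))
    (y : DyadicCube n → Lp 𝕜 2 μ) : ℕ → DyadicCube n → ℝ
  | 0, _ => 0
  | N + 1, Q => ‖cut μ (E Q.scale) (y Q)‖ ^ 2 + ∑ ε, treeSum E y N (Q.child ε)

/-- Passing from Q to its children removes E at the scale of Q from the penalized set. The energy of
the maximizer y_Q is therefore the sum of the energies of its restrictions to the children, minus s
‖1_E y_Q‖²; this loss pays for the term of Q in the tree sum. The bound is stated for every v
because the restrictions of y_Q are not the maximizers of the children. At the bottom the energy is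
at most ‖1_Q f‖² by completing the square. -/
theorem energy_add_treeSum_le {D : DyadicGrid n} {s : ℝ} (hs : 0 ≤ s)
    {E : ℤ → Set (EuclideanSpace ℝ (Fin n))}
    (hE : ∀ k, MeasurableSet (E k)) (hd : Pairwise (Function.onFun Disjoint E)) (a : ℤ)
    {f : Lp 𝕜 2 μ} {y : DyadicCube n → Lp 𝕜 2 μ}
    (hy : ∀ Q, IsReweightedProj μ P s (⋃ k ∈ Finset.Icc a Q.scale, E k) Q f (y Q))
    (N : ℕ) : ∀ Q ∈ D.cubes, Q.scale = a - 1 + N → ∀ v ∈ localSpace μ P Q.toSet,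
      energy s (⋃ k ∈ Finset.Icc a Q.scale, E k) f v + s * treeSum E y N Q ≤
        ‖cut μ Q.toSet f‖ ^ 2 := by
  have hSm : ∀ k, MeasurableSet (⋃ j ∈ Finset.Icc a k, E j) := fun k =>
    Finset.measurableSet_biUnion _ fun j _ => hE j
  induction N with
  | zero =>
    intro Q hQ hsc v hv
    have h1 := cut_eq_of_mem_localSpace Q.measurableSet_toSet hv
    have h2 : ⟪v, f⟫_𝕜 = ⟪v, cut μ Q.toSet f⟫_𝕜 := by
      rw [← cut_inner Q.measurableSet_toSet, h1]
    have h3 := sq_nonneg ‖v - cut μ Q.toSet f‖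
    rw [norm_sub_sq (𝕜 := 𝕜)] at h3
    have h4 := mul_nonneg hs (sq_nonneg ‖cut μ (⋃ k ∈ Finset.Icc a Q.scale, E k) v‖)
    simp only [energy, treeSum, h2]
    linarith
  | succ N ih =>
    intro Q hQ hsc v hv
    have hQm := Q.measurableSet_toSet
    refine le_trans (add_le_add_left (energy_le hs (hSm _) (hy Q) hv) _) ?_
    have hyQ := cut_eq_of_mem_localSpace hQm (hy Q).1
    have hunion : ⋃ k ∈ Finset.Icc a Q.scale, E k =
        (⋃ k ∈ Finset.Icc a (Q.scale - 1), E k) ∪ E Q.scale := by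
      have : Finset.Icc a Q.scale = insert Q.scale (Finset.Icc a (Q.scale - 1)) := by
        ext k
        simp only [Finset.mem_Icc, Finset.mem_insert]
        push_cast at hsc
        omega
      rw [this, Finset.set_biUnion_insert, Set.union_comm]
    have hdisj : Disjoint (⋃ k ∈ Finset.Icc a (Q.scale - 1), E k) (E Q.scale) := by
      rw [Set.disjoint_iUnion₂_left]
      intro k hk
      refine hd ?_
      rw [Finset.mem_Icc] at hk
      omega
    have h1 : ‖cut μ (⋃ k ∈ Finset.Icc a Q.scale, E k) (y Q)‖ ^ 2 =
        (∑ ε, ‖cut μ (⋃ k ∈ Finset.Icc a (Q.scale - 1), E k)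
          (cut μ (Q.child ε).toSet (y Q))‖ ^ 2) + ‖cut μ (E Q.scale) (y Q)‖ ^ 2 := by
      rw [hunion, norm_cut_union_sq (hSm _) (hE _) hdisj]
      congr 1
      simp_rw [cut_comm (hSm (Q.scale - 1)) (DyadicCube.measurableSet_toSet _)]
      rw [sum_norm_cut_child_sq, cut_comm hQm (hSm _), hyQ]
    have h2 : ‖y Q‖ ^ 2 = ∑ ε, ‖cut μ (Q.child ε).toSet (y Q)‖ ^ 2 := by
      rw [sum_norm_cut_child_sq, hyQ]
    have h3 : RCLike.re ⟪y Q, f⟫_𝕜 = ∑ ε, RCLike.re ⟪cut μ (Q.child ε).toSet (y Q), f⟫_𝕜 := by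
      rw [← map_sum, ← sum_inner, sum_cut_child, hyQ]
    have h4 : energy s (⋃ k ∈ Finset.Icc a Q.scale, E k) f (y Q) =
        (∑ ε, energy s (⋃ k ∈ Finset.Icc a (Q.scale - 1), E k) f
          (cut μ (Q.child ε).toSet (y Q))) - s * ‖cut μ (E Q.scale) (y Q)‖ ^ 2 := by
      simp only [energy, Finset.sum_sub_distrib, ← Finset.mul_sum]
      rw [h1, h2, h3]
      ring
    rw [h4, treeSum, ← sum_norm_cut_child_sq, mul_add, Finset.mul_sum]
    have h5 := Finset.sum_le_sum fun ε (_ : ε ∈ Finset.univ) =>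
      ih (Q.child ε) (D.child_mem Q hQ ε) (by rw [DyadicCube.child_scale, hsc]; push_cast; ring)
        _ (cut_mem_localSpace (Q.child ε).measurableSet_toSet (Q.child_subset ε) (hy Q).1)
    rw [Finset.sum_add_distrib] at h5
    simp only [DyadicCube.child_scale] at h5
    linarith

/-- Cauchy–Schwarz over the d summands, cube by cube. The coefficients may vary with the cube; only
their common bound enters. -/
theorem treeSum_le {E : ℤ → Set (EuclideanSpace ℝ (Fin n))} {d : ℕ} {C : ℝ}
    {x : DyadicCube n → Lp 𝕜 2 μ} {y : Fin d → DyadicCube n → Lp 𝕜 2 μ}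
    {c : Fin d → DyadicCube n → 𝕜} (hc : ∀ i Q, ‖c i Q‖ ≤ C)
    (hx : ∀ Q, x Q = ∑ i, c i Q • y i Q) (N : ℕ) (Q : DyadicCube n) :
    treeSum E x N Q ≤ d * C ^ 2 * ∑ i, treeSum E (y i) N Q := by
  induction N generalizing Q with
  | zero => simp [treeSum]
  | succ N ih =>
    simp only [treeSum]
    rw [Finset.sum_add_distrib, mul_add]
    refine add_le_add ?_ ?_
    · have h1 : ‖cut μ (E Q.scale) (x Q)‖ ≤ ∑ i, C * ‖cut μ (E Q.scale) (y i Q)‖ := by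
        rw [hx, map_sum]
        refine (norm_sum_le _ _).trans (Finset.sum_le_sum fun i _ => ?_)
        rw [map_smul, norm_smul]
        exact mul_le_mul_of_nonneg_right (hc i Q) (norm_nonneg _)
      refine (pow_le_pow_left₀ (norm_nonneg _) h1 2).trans ?_
      refine sq_sum_le_card_mul_sum_sq.trans_eq ?_
      simp_rw [mul_pow, ← Finset.mul_sum, Finset.card_fin, mul_assoc]
    · rw [Finset.sum_comm, Finset.mul_sum]
      exact Finset.sum_le_sum fun ε _ => ih _

theorem measure_toSet_ne_top [IsLocallyFiniteMeasure μ] (Q : DyadicCube n) :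
    μ Q.toSet ≠ ⊤ := by
  obtain ⟨K, hK, hQK⟩ := Q.exists_isCompact_superset
  exact ((measure_mono hQK).trans_lt hK.measure_lt_top).ne

theorem sq_mul_measureReal_le {A : Set (EuclideanSpace ℝ (Fin n))} (hA : MeasurableSet A)
    (hfin : μ A ≠ ⊤) {t : ℝ} (ht : 0 ≤ t) {g : Lp 𝕜 2 μ} (hg : ∀ z ∈ A, t ≤ ‖g z‖) :
    t ^ 2 * μ.real A ≤ ‖cut μ A g‖ ^ 2 := by
  calc t ^ 2 * μ.real A = ∫ _ in A, t ^ 2 ∂μ := by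
        rw [setIntegral_const, smul_eq_mul, mul_comm]
    _ ≤ ∫ z in A, ‖g z‖ ^ 2 ∂μ :=
        setIntegral_mono_on (integrableOn_const hfin) (integrable_norm_sq _).integrableOn hA
          fun z hz => pow_le_pow_left₀ ht (hg z hz) 2
    _ = ‖cut μ A g‖ ^ 2 := (norm_cut_sq hA _).symm

/-- Chebyshev's inequality on Q ∩ E for each cube Q of the tree, with E at the scale of Q; the
points of Q in sets E_k of smaller scale are distributed among the children. -/
theorem sq_mul_measureReal_le_treeSum [IsLocallyFiniteMeasure μ]
    {E : ℤ → Set (EuclideanSpace ℝ (Fin n))} (hE : ∀ k, MeasurableSet (E k)) {t : ℝ} (ht : 0 ≤ t)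
    {x : DyadicCube n → Lp 𝕜 2 μ} {D : DyadicGrid n}
    (hx : ∀ Q ∈ D.cubes, ∀ z ∈ Q.toSet ∩ E Q.scale, t ≤ ‖x Q z‖) (a : ℤ) (N : ℕ) :
    ∀ Q ∈ D.cubes, Q.scale = a - 1 + N →
      t ^ 2 * μ.real (Q.toSet ∩ ⋃ k ∈ Finset.Icc a Q.scale, E k) ≤ treeSum E x N Q := by
  induction N with
  | zero =>
    intro Q _ hsc
    have : Finset.Icc a Q.scale = ∅ := Finset.Icc_eq_empty (by push_cast at hsc; omega)
    simp [this, treeSum]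
  | succ N ih =>
    intro Q hQ hsc
    have hsub : Q.toSet ∩ ⋃ k ∈ Finset.Icc a Q.scale, E k ⊆ (Q.toSet ∩ E Q.scale) ∪
        ⋃ ε ∈ (Finset.univ : Finset (Fin n → Bool)),
          (Q.child ε).toSet ∩ ⋃ k ∈ Finset.Icc a (Q.child ε).scale, E k := by
      rintro z ⟨hz, hz'⟩
      simp only [Set.mem_iUnion, Finset.mem_Icc, exists_prop] at hz'
      obtain ⟨k, hk, hzk⟩ := hz'
      by_cases hkQ : k = Q.scale
      · exact Or.inl ⟨hz, hkQ ▸ hzk⟩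
      · right
        obtain ⟨ε, hε⟩ := DyadicCube.exists_mem_child hz
        simp only [Set.mem_iUnion, Finset.mem_univ, exists_prop, true_and]
        refine ⟨ε, hε, ?_⟩
        simp only [Set.mem_iUnion, Finset.mem_Icc, exists_prop, DyadicCube.child_scale]
        exact ⟨k, by omega, hzk⟩
    have h1 : t ^ 2 * μ.real (Q.toSet ∩ E Q.scale) ≤ ‖cut μ (E Q.scale) (x Q)‖ ^ 2 := by
      have hm := Q.measurableSet_toSet.inter (hE Q.scale)
      refine (sq_mul_measureReal_le hm (measure_ne_top_of_subset Set.inter_subset_left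
        (measure_toSet_ne_top Q)) ht fun z hz => hx Q hQ z hz).trans ?_
      rw [← cut_cut Q.measurableSet_toSet (hE _)]
      exact pow_le_pow_left₀ (norm_nonneg _) (norm_cut_le _) 2
    have h2 : μ.real (Q.toSet ∩ ⋃ k ∈ Finset.Icc a Q.scale, E k) ≤ μ.real (Q.toSet ∩ E Q.scale) +
        ∑ ε, μ.real ((Q.child ε).toSet ∩ ⋃ k ∈ Finset.Icc a (Q.child ε).scale, E k) := by
      refine (measureReal_mono hsub ?_).trans ?_
      · refine measure_ne_top_of_subset (Set.union_subset Set.inter_subset_left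
          (Set.iUnion₂_subset fun ε _ => Set.inter_subset_left.trans (Q.child_subset ε))) (measure_toSet_ne_top Q)
      · exact (measureReal_union_le _ _).trans
          (add_le_add_right (measureReal_biUnion_finset_le _ _) _)
    rw [treeSum]
    refine (mul_le_mul_of_nonneg_left h2 (sq_nonneg t)).trans ?_
    rw [mul_add, Finset.mul_sum]
    refine add_le_add h1 (Finset.sum_le_sum fun ε _ => ?_)
    exact ih (Q.child ε) (D.child_mem Q hQ ε)
      (by rw [DyadicCube.child_scale, hsc]; push_cast; ring)

end Energy

/-! ### The maximal inequality and differentiation over shrinking cubes. -/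

section SmallScale

variable {𝕜 : Type*} [RCLike 𝕜] {n : ℕ} {μ : Measure (EuclideanSpace ℝ (Fin n))}
  {P : Submodule 𝕜 (EuclideanSpace ℝ (Fin n) → 𝕜)}

theorem treeSum_nonneg (E : ℤ → Set (EuclideanSpace ℝ (Fin n)))
    (y : DyadicCube n → Lp 𝕜 2 μ) (N : ℕ) (Q : DyadicCube n) : 0 ≤ treeSum E y N Q := by
  induction N generalizing Q with
  | zero => exact le_rfl
  | succ N ih => exact add_nonneg (sq_nonneg _) (Finset.sum_nonneg fun ε _ => ih _)

/-- The constant of the maximal inequality, for a space of functions of dimension `d`. -/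
noncomputable def maximalConst (d : ℕ) : ℝ := d * resolventConst d ^ 2 * d

theorem maximalConst_nonneg (d : ℕ) : 0 ≤ maximalConst d := by
  unfold maximalConst
  positivity

variable [FiniteDimensional 𝕜 P] [IsLocallyFiniteMeasure μ]

omit [IsLocallyFiniteMeasure μ] in
theorem measurableSet_lt_norm_expProj (D : DyadicGrid n) (f : Lp 𝕜 2 μ) (t : ℝ) (k : ℤ) :
    MeasurableSet {x | t < ‖expProj μ P (D.cubeAt k x).toSet f x‖} := by
  have : {x | t < ‖expProj μ P (D.cubeAt k x).toSet f x‖} =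
      ⋃ Q ∈ {Q ∈ D.cubes | Q.scale = k}, Q.toSet ∩ {x | t < ‖expProj μ P Q.toSet f x‖} := by
    ext x
    simp only [Set.mem_iUnion, exists_prop, Set.mem_inter_iff, Set.mem_ofPred_eq]
    constructor
    · exact fun hx => ⟨_, ⟨D.cubeAt_mem k x, D.cubeAt_scale k x⟩, D.mem_cubeAt k x, hx⟩
    · rintro ⟨Q, ⟨hQ, hk⟩, hx, hx'⟩
      rw [DyadicGrid.cubeAt_eq hQ hk hx]
      exact hx'
  rw [this]
  refine MeasurableSet.biUnion (D.countable_cubes.mono fun Q hQ => hQ.1) fun Q _ => ?_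
  have hm : Measurable fun x => ‖expProj μ P Q.toSet f x‖ :=
    (Lp.stronglyMeasurable (expProj μ P Q.toSet f)).measurable.norm
  exact Q.measurableSet_toSet.inter (measurableSet_lt measurable_const hm)

/-- The tree estimates are applied with E_k the set where the projection exceeds t at scale k and at
no larger scale up to that of Q. The lower cutoff a makes the tree finite, and the bound does not
depend on it. -/
theorem sq_mul_measureReal_maximal_le (hP : ∀ φ ∈ P, LocL2 μ φ) {D : DyadicGrid n}
    {Q : DyadicCube n} (hQ : Q ∈ D.cubes) (f : Lp 𝕜 2 μ) {t : ℝ} (ht : 0 ≤ t) (a : ℤ) :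
    t ^ 2 * μ.real (Q.toSet ∩ {x | ∃ k, a ≤ k ∧ k ≤ Q.scale ∧
      t < ‖expProj μ P (D.cubeAt k x).toSet f x‖}) ≤
      maximalConst (Module.finrank 𝕜 P) * ‖f‖ ^ 2 := by
  have hC := maximalConst_nonneg (Module.finrank 𝕜 P)
  rcases lt_or_ge Q.scale a with hlt | hle
  · have : {x | ∃ k, a ≤ k ∧ k ≤ Q.scale ∧
        t < ‖expProj μ P (D.cubeAt k x).toSet f x‖} = ∅ := by
      rw [Set.eq_empty_iff_forall_notMem]
      rintro x ⟨k, h1, h2, -⟩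
      omega
    rw [this, Set.inter_empty, measureReal_empty, mul_zero]
    positivity
  let F : ℤ → Set (EuclideanSpace ℝ (Fin n)) := fun k =>
    {x | k ≤ Q.scale ∧ t < ‖expProj μ P (D.cubeAt k x).toSet f x‖}
  have hF : ∀ k, MeasurableSet (F k) := fun k =>
    (MeasurableSet.const _).inter (measurableSet_lt_norm_expProj D f t k)
  -- Stopping at the largest scale makes the sets disjoint, as the energy argument requires.
  let E : ℤ → Set (EuclideanSpace ℝ (Fin n)) := fun k => F k \ ⋃ j ∈ Set.Ioi k, F j
  have hE : ∀ k, MeasurableSet (E k) := fun k =>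
    (hF k).diff (MeasurableSet.biUnion (Set.to_countable _) fun j _ => hF j)
  have hd' : ∀ i j, i < j → Disjoint (E i) (E j) := by
    intro i j hij
    rw [Set.disjoint_left]
    intro x hx hx'
    exact hx.2 (Set.mem_biUnion (Set.mem_Ioi.2 hij) hx'.1)
  have hd : Pairwise (Function.onFun Disjoint E) := by
    intro i j hij
    rcases hij.lt_or_gt with h | h
    · exact hd' i j h
    · exact (hd' j i h).symm
  choose y c hc hx hy using fun R : DyadicCube n => exists_isReweightedProj_combination hP
    (Finset.measurableSet_biUnion (Finset.Icc a R.scale) fun j _ => hE j) R f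
  obtain ⟨N, hN⟩ := Int.eq_ofNat_of_zero_le (show 0 ≤ Q.scale - (a - 1) by omega)
  have hsc : Q.scale = a - 1 + N := by rw [← hN]; ring
  have hsub : Q.toSet ∩ {x | ∃ k, a ≤ k ∧ k ≤ Q.scale ∧
      t < ‖expProj μ P (D.cubeAt k x).toSet f x‖} ⊆
      Q.toSet ∩ ⋃ k ∈ Finset.Icc a Q.scale, E k := by
    rintro x ⟨hxQ, k, hak, hkQ, hk⟩
    refine ⟨hxQ, ?_⟩
    obtain ⟨m, hm, hmax⟩ := Int.exists_greatest_of_bdd (P := fun j => x ∈ F j)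
      ⟨Q.scale, fun j hj => hj.1⟩ ⟨k, hkQ, hk⟩
    have hkm := hmax k ⟨hkQ, hk⟩
    refine Set.mem_biUnion (Finset.mem_coe.2 (Finset.mem_Icc.2 ⟨hak.trans hkm, hm.1⟩)) ⟨hm, ?_⟩
    simp only [Set.mem_iUnion, not_exists]
    intro j hj hxj
    exact absurd (hmax j hxj) (not_le.2 hj)
  have h1 : t ^ 2 * μ.real (Q.toSet ∩ ⋃ k ∈ Finset.Icc a Q.scale, E k) ≤
      treeSum E (fun R => expProj μ P R.toSet f) N Q := by
    refine sq_mul_measureReal_le_treeSum hE ht (D := D) (fun R hR z hz => ?_) a N Q hQ hsc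
    have := hz.2.1.2
    rw [DyadicGrid.cubeAt_eq hR rfl hz.1] at this
    exact this.le
  have h2 : ∀ i : Fin (Module.finrank 𝕜 P), treeSum E (fun R => y R i) N Q ≤ ‖f‖ ^ 2 := by
    intro i
    -- At the top the competitor v = 0 has energy 0. Since the weight i + 1 is at least 1, it can be
    -- dropped from the resulting bound.
    have h3 := energy_add_treeSum_le (D := D) (s := (i : ℝ) + 1) (by positivity) hE hd a
      (fun R => hy R i) N Q hQ hsc 0 (Submodule.zero_mem _)
    have h4 : energy ((i : ℝ) + 1) (⋃ k ∈ Finset.Icc a Q.scale, E k) f (0 : Lp 𝕜 2 μ) = 0 := by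
      simp [energy]
    have h5 := treeSum_nonneg E (fun R => y R i) N Q
    have h6 : ‖cut μ Q.toSet f‖ ^ 2 ≤ ‖f‖ ^ 2 :=
      pow_le_pow_left₀ (norm_nonneg _) (norm_cut_le f) 2
    have h7 : 0 ≤ (i : ℝ) * treeSum E (fun R => y R i) N Q := by positivity
    rw [h4] at h3
    linarith
  -- One factor dim `P` of the constant comes from Cauchy–Schwarz, the other from the number of
  -- weights.
  calc _ ≤ t ^ 2 * μ.real (Q.toSet ∩ ⋃ k ∈ Finset.Icc a Q.scale, E k) :=
        mul_le_mul_of_nonneg_left (measureReal_mono hsub (measure_ne_top_of_subset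
          Set.inter_subset_left (measure_toSet_ne_top Q))) (sq_nonneg t)
    _ ≤ treeSum E (fun R => expProj μ P R.toSet f) N Q := h1
    _ ≤ Module.finrank 𝕜 P * resolventConst (Module.finrank 𝕜 P) ^ 2 *
          ∑ i, treeSum E (fun R => y R i) N Q :=
        treeSum_le (fun i R => hc R i) hx N Q
    _ ≤ Module.finrank 𝕜 P * resolventConst (Module.finrank 𝕜 P) ^ 2 *
          ∑ _i : Fin (Module.finrank 𝕜 P), ‖f‖ ^ 2 :=
        mul_le_mul_of_nonneg_left (Finset.sum_le_sum fun i _ => h2 i) (by positivity)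
    _ = _ := by
        rw [Finset.sum_const, Finset.card_fin, nsmul_eq_mul, maximalConst]
        ring

/-- The weak type inequality for the maximal function of the projections onto the local spaces
of the cubes that contain a point. -/
theorem measure_maximal_le (hP : ∀ φ ∈ P, LocL2 μ φ) {D : DyadicGrid n}
    {Q : DyadicCube n} (hQ : Q ∈ D.cubes) (f : Lp 𝕜 2 μ) {t : ℝ} (ht : 0 < t) :
    μ (Q.toSet ∩ {x | ∃ k ≤ Q.scale, t < ‖expProj μ P (D.cubeAt k x).toSet f x‖}) ≤
      ENNReal.ofReal (maximalConst (Module.finrank 𝕜 P) * ‖f‖ ^ 2 / t ^ 2) := by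
  let A : ℕ → Set (EuclideanSpace ℝ (Fin n)) := fun m => Q.toSet ∩
    {x | ∃ k, -(m : ℤ) ≤ k ∧ k ≤ Q.scale ∧ t < ‖expProj μ P (D.cubeAt k x).toSet f x‖}
  have hA : Q.toSet ∩ {x | ∃ k ≤ Q.scale, t < ‖expProj μ P (D.cubeAt k x).toSet f x‖} =
      ⋃ m, A m := by
    ext x
    simp only [A, Set.mem_iUnion, Set.mem_inter_iff]
    constructor
    · rintro ⟨hx, k, hk, hxk⟩
      exact ⟨(-k).toNat, hx, k, by omega, hk, hxk⟩
    · rintro ⟨m, hx, k, -, hk, hxk⟩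
      exact ⟨hx, k, hk, hxk⟩
  have hmono : Monotone A := by
    rintro i j hij x ⟨hx, k, h1, h2⟩
    exact ⟨hx, k, by omega, h2⟩
  rw [hA, hmono.measure_iUnion]
  refine iSup_le fun m => ?_
  have hfin : μ (A m) ≠ ⊤ :=
    measure_ne_top_of_subset Set.inter_subset_left (measure_toSet_ne_top Q)
  rw [← ENNReal.ofReal_toReal hfin]
  refine ENNReal.ofReal_le_ofReal ?_
  rw [le_div_iff₀ (by positivity), mul_comm]
  exact sq_mul_measureReal_maximal_le hP hQ f ht.le _

omit [FiniteDimensional 𝕜 P] [IsLocallyFiniteMeasure μ] in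
theorem ae_forall_cubeAt (D : DyadicGrid n) {p : DyadicCube n → EuclideanSpace ℝ (Fin n) → Prop}
    (h : ∀ Q ∈ D.cubes, ∀ᵐ x ∂μ, p Q x) : ∀ᵐ x ∂μ, ∀ k : ℤ, p (D.cubeAt k x) x := by
  filter_upwards [(ae_ball_iff D.countable_cubes).2 h] with x hx k
  exact hx _ (D.cubeAt_mem k x)

omit [IsLocallyFiniteMeasure μ] in
theorem ae_expProj_add (D : DyadicGrid n) (f g : Lp 𝕜 2 μ) :
    ∀ᵐ x ∂μ, ∀ k : ℤ, expProj μ P (D.cubeAt k x).toSet (f + g) x =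
      expProj μ P (D.cubeAt k x).toSet f x + expProj μ P (D.cubeAt k x).toSet g x := by
  refine ae_forall_cubeAt D (p := fun Q x => expProj μ P Q.toSet (f + g) x =
    expProj μ P Q.toSet f x + expProj μ P Q.toSet g x) fun Q _ => ?_
  rw [map_add]
  exact Lp.coeFn_add _ _

omit [IsLocallyFiniteMeasure μ] in
-- If h is in the local space of R and Q is no longer than R, then Q is inside R or disjoint from
-- it, and E_Q h = 1_Q h in both cases. Finite sums inherit the conclusion for sufficiently small
-- scales.
theorem ae_eventually_expProj_eq (D : DyadicGrid n) {h : Lp 𝕜 2 μ}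
    (hh : h ∈ ⨆ Q : D.cubes, localSpace μ P Q.1.toSet) :
    ∀ᵐ x ∂μ, ∀ᶠ k : ℤ in atBot, expProj μ P (D.cubeAt k x).toSet h x = h x := by
  induction hh using Submodule.iSup_induction' with
  | mem R h hh =>
    have h1 : ∀ Q ∈ D.cubes, ∀ᵐ x ∂μ, Q.scale ≤ R.1.scale → x ∈ Q.toSet →
        expProj μ P Q.toSet h x = h x := by
      intro Q hQ
      have hQm := Q.measurableSet_toSet
      by_cases hs : Q.scale ≤ R.1.scale
      · have h2 : expProj μ P Q.toSet h = cut μ Q.toSet h := by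
          rcases DyadicGrid.disjoint_or_subset hQ R.2 hs with hd | hsub
          · rw [← cut_eq_of_mem_localSpace R.1.measurableSet_toSet hh,
              cut_cut_of_disjoint hQm R.1.measurableSet_toSet hd]
            refine expProj_eq_zero_of_cut hQm (cut_cut_of_disjoint hQm ?_ hd h)
            exact R.1.measurableSet_toSet
          · rw [← expProj_cut hQm]
            exact expProj_eq (cut_mem_localSpace hQm hsub hh) fun _ _ => rfl
        filter_upwards [cut_coeFn hQm h] with x hx _ hxQ
        rw [h2, hx, Set.indicator_of_mem hxQ]
      · exact Eventually.of_forall fun x h => absurd h hs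
    filter_upwards [ae_forall_cubeAt D h1] with x hx
    filter_upwards [eventually_le_atBot R.1.scale] with k hk
    exact hx k (by rwa [D.cubeAt_scale]) (D.mem_cubeAt k x)
  | zero =>
    have h1 := ae_forall_cubeAt (μ := μ) D (p := fun Q x => expProj μ P Q.toSet 0 x = 0)
      fun Q _ => by rw [map_zero]; exact Lp.coeFn_zero 𝕜 2 μ
    filter_upwards [h1, Lp.coeFn_zero 𝕜 2 μ] with x hx h0
    exact Eventually.of_forall fun k => (hx k).trans h0.symm
  | add f g _ _ hf hg =>
    filter_upwards [hf, hg, ae_expProj_add (P := P) D f g, Lp.coeFn_add f g] with x h1 h2 h3 h4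
    filter_upwards [h1, h2] with k h5 h6
    rw [h3, h4, h5, h6, Pi.add_apply]

omit [FiniteDimensional 𝕜 P] in
theorem topologicalClosure_iSup_localSpace (hP : ∀ φ ∈ P, LocL2 μ φ)
    (hone : (fun _ => 1 : EuclideanSpace ℝ (Fin n) → 𝕜) ∈ P) (D : DyadicGrid n) :
    (⨆ Q : D.cubes, localSpace μ P Q.1.toSet).topologicalClosure = ⊤ := by
  rw [Submodule.topologicalClosure_eq_top_iff, Submodule.eq_bot_iff]
  intro f hf
  refine eq_zero_of_forall_inner_localSpace_eq_zero hP hone D f fun Q hQ v hv => ?_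
  exact hf v (Submodule.mem_iSup_of_mem (⟨Q, hQ⟩ : D.cubes) hv)

/-- At small scales h drops out: E_Q f − f = E_Q(f − h) − (f − h). The two terms are controlled by
the maximal inequality and by Chebyshev's inequality. -/
theorem measure_not_eventually_le (hP : ∀ φ ∈ P, LocL2 μ φ) {D : DyadicGrid n}
    {Q : DyadicCube n} (hQ : Q ∈ D.cubes) (f : Lp 𝕜 2 μ) {h : Lp 𝕜 2 μ}
    (hh : h ∈ ⨆ Q : D.cubes, localSpace μ P Q.1.toSet) {t : ℝ} (ht : 0 < t) :
    μ (Q.toSet ∩ {x | ¬ ∀ᶠ k : ℤ in atBot,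
      ‖expProj μ P (D.cubeAt k x).toSet f x - f x‖ ≤ 2 * t}) ≤
      ENNReal.ofReal (maximalConst (Module.finrank 𝕜 P) * ‖f - h‖ ^ 2 / t ^ 2) +
        ENNReal.ofReal (‖f - h‖ ^ 2 / t ^ 2) := by
  have hA : MeasurableSet (Q.toSet ∩ {x | t ≤ ‖(f - h) x‖}) :=
    Q.measurableSet_toSet.inter (measurableSet_le measurable_const
      (Lp.stronglyMeasurable (f - h)).norm.measurable)
  have hAfin : μ (Q.toSet ∩ {x | t ≤ ‖(f - h) x‖}) ≠ ⊤ :=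
    measure_ne_top_of_subset Set.inter_subset_left (measure_toSet_ne_top Q)
  have h1 : μ (Q.toSet ∩ {x | t ≤ ‖(f - h) x‖}) ≤ ENNReal.ofReal (‖f - h‖ ^ 2 / t ^ 2) := by
    rw [← ENNReal.ofReal_toReal hAfin]
    refine ENNReal.ofReal_le_ofReal ?_
    rw [le_div_iff₀ (by positivity), mul_comm]
    exact (sq_mul_measureReal_le hA hAfin ht.le fun z hz => hz.2).trans
      (pow_le_pow_left₀ (norm_nonneg _) (norm_cut_le _) 2)
  refine le_trans ?_ (add_le_add (measure_maximal_le hP hQ (f - h) ht) h1)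
  refine le_trans (measure_mono_ae ?_) (measure_union_le _ _)
  have h2 := ae_expProj_add (μ := μ) (P := P) D h (f - h)
  rw [add_sub_cancel] at h2
  filter_upwards [h2, ae_eventually_expProj_eq D hh, Lp.coeFn_sub f h] with x h3 h4 h5
  rintro ⟨hxQ, hx⟩
  by_contra hcon
  apply hx
  have h6 : ∀ k ≤ Q.scale, ‖expProj μ P (D.cubeAt k x).toSet (f - h) x‖ ≤ t := by
    intro k hk
    by_contra! hlt
    exact hcon (Or.inl ⟨hxQ, k, hk, hlt⟩)
  have h7 : ‖(f - h) x‖ ≤ t := by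
    by_contra! hlt
    exact hcon (Or.inr ⟨hxQ, hlt.le⟩)
  filter_upwards [h4, eventually_le_atBot Q.scale] with k h8 h9
  have h10 : expProj μ P (D.cubeAt k x).toSet f x - f x =
      expProj μ P (D.cubeAt k x).toSet (f - h) x - (f - h) x := by
    rw [h3, h8, h5, Pi.sub_apply]
    ring
  rw [h10]
  refine (norm_sub_le _ _).trans ?_
  linarith [h6 k h9]

/-- The differentiation theorem for the projections onto the local spaces of the cubes of a
dyadic grid. -/
theorem ae_tendsto_expProj_atBot (hP : ∀ φ ∈ P, LocL2 μ φ)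
    (hone : (fun _ => 1 : EuclideanSpace ℝ (Fin n) → 𝕜) ∈ P) (D : DyadicGrid n)
    (f : Lp 𝕜 2 μ) :
    ∀ᵐ x ∂μ, Tendsto (fun k : ℤ => expProj μ P (D.cubeAt k x).toSet f x) atBot (𝓝 (f x)) := by
  have hmem : f ∈ (⨆ Q : D.cubes, localSpace μ P Q.1.toSet).topologicalClosure := by
    rw [topologicalClosure_iSup_localSpace hP hone D]
    exact Submodule.mem_top
  obtain ⟨h, hh, hlim⟩ := mem_closure_iff_seq_limit.1 hmem
  have hnorm : Tendsto (fun j => ‖f - h j‖ ^ 2) atTop (𝓝 0) := by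
    have := ((tendsto_const_nhds (x := f)).sub hlim).norm.pow 2
    simpa using this
  -- The exceptional set does not depend on the approximant h_j, while its bound tends to 0 with j.
  have hnull : ∀ Q ∈ D.cubes, ∀ t : ℝ, 0 < t → μ (Q.toSet ∩ {x | ¬ ∀ᶠ k : ℤ in atBot,
      ‖expProj μ P (D.cubeAt k x).toSet f x - f x‖ ≤ 2 * t}) = 0 := by
    intro Q hQ t ht
    have h1 : Tendsto (fun j =>
        ENNReal.ofReal (maximalConst (Module.finrank 𝕜 P) * ‖f - h j‖ ^ 2 / t ^ 2) +
        ENNReal.ofReal (‖f - h j‖ ^ 2 / t ^ 2)) atTop (𝓝 0) := by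
      have h2 := ENNReal.tendsto_ofReal
        ((hnorm.const_mul (maximalConst (Module.finrank 𝕜 P))).div_const (t ^ 2))
      have h3 := ENNReal.tendsto_ofReal (hnorm.div_const (t ^ 2))
      simpa using h2.add h3
    exact le_antisymm (ge_of_tendsto' h1 fun j =>
      measure_not_eventually_le hP hQ f (hh j) ht) zero_le
  have hae : ∀ᵐ x ∂μ, ∀ Q : D.cubes, ∀ m : ℕ, x ∈ Q.1.toSet → ∀ᶠ k : ℤ in atBot,
      ‖expProj μ P (D.cubeAt k x).toSet f x - f x‖ ≤ 2 * (1 / ((m : ℝ) + 1)) := by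
    simp_rw [ae_all_iff]
    intro Q m
    rw [ae_iff]
    convert hnull Q.1 Q.2 (1 / ((m : ℝ) + 1)) (by positivity) using 2
    ext x
    simp only [Classical.not_imp]
    rfl
  filter_upwards [hae] with x hx
  rw [Metric.tendsto_nhds]
  intro ε hε
  obtain ⟨m, hm⟩ := exists_nat_one_div_lt (half_pos hε)
  filter_upwards [hx ⟨_, D.cubeAt_mem 0 x⟩ m (D.mem_cubeAt 0 x)] with k hk
  rw [dist_eq_norm]
  linarith

end SmallScale

/-! ### Telescoping, completeness and assembly of the theorem. -/

theorem sum_Icc_sub {M : Type*} [AddCommGroup M] (F : ℤ → M) {a b : ℤ} (h : a - 1 ≤ b) :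
    ∑ k ∈ Finset.Icc a b, (F (k - 1) - F k) = F (a - 1) - F b := by
  induction b, h using Int.leInduction with
  | base => simp
  | succ b hb ih =>
    have : Finset.Icc a (b + 1) = insert (b + 1) (Finset.Icc a b) := by
      ext k
      simp only [Finset.mem_Icc, Finset.mem_insert]
      omega
    rw [this, Finset.sum_insert (by simp), ih, add_sub_cancel_right]
    abel

section Main

variable {𝕜 : Type*} [RCLike 𝕜] {n : ℕ} {μ : Measure (EuclideanSpace ℝ (Fin n))}
  {P : Submodule 𝕜 (EuclideanSpace ℝ (Fin n) → 𝕜)} [FiniteDimensional 𝕜 P]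

theorem ae_alpertProj_eq_zero (hP : ∀ φ ∈ P, LocL2 μ φ) (D : DyadicGrid n) (f : Lp 𝕜 2 μ) :
    ∀ᵐ x ∂μ, ∀ Q ∈ D.cubes, x ∉ Q.toSet → alpertProj μ P Q f x = 0 := by
  refine (ae_ball_iff D.countable_cubes).2 fun Q _ => ?_
  have h := cut_coeFn Q.measurableSet_toSet (alpertProj μ P Q f)
  rw [cut_alpertProj hP] at h
  filter_upwards [h] with x hx hxQ
  rw [hx, Set.indicator_of_notMem hxQ]

theorem ae_expProj_eq_zero {S : Set (EuclideanSpace ℝ (Fin n))} (hS : MeasurableSet S)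
    (f : Lp 𝕜 2 μ) : ∀ᵐ x ∂μ, x ∉ S → expProj μ P S f x = 0 := by
  have h := cut_coeFn hS (expProj μ P S f)
  rw [cut_expProj hS] at h
  filter_upwards [h] with x hx hxS
  rw [hx, Set.indicator_of_notMem hxS]

theorem ae_sum_expProj_tops (D : DyadicGrid n) (f : Lp 𝕜 2 μ) :
    ∀ᵐ x ∂μ, ∑ T ∈ D.finite_tops.toFinset, expProj μ P T f x = expProj μ P (D.topAt x) f x := by
  have h : ∀ᵐ x ∂μ, ∀ T ∈ D.tops, x ∉ T → expProj μ P T f x = 0 :=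
    (ae_ball_iff D.finite_tops.countable).2 fun T hT =>
      ae_expProj_eq_zero (DyadicGrid.measurableSet_top hT) f
  filter_upwards [h] with x hx
  refine Finset.sum_eq_single _ (fun T hT hne => ?_) fun hT => ?_
  · rw [Set.Finite.mem_toFinset] at hT
    exact hx T hT fun hxT => hne (DyadicGrid.eq_topAt hT hxT)
  · exact absurd (D.finite_tops.mem_toFinset.2 (DyadicGrid.topAt_mem_tops x)) hT

/-- On the child that contains x the other children contribute nothing, so the operator identity
becomes a difference of consecutive terms. -/
theorem ae_alpertProj_cubeAt (hP : ∀ φ ∈ P, LocL2 μ φ) (D : DyadicGrid n) (f : Lp 𝕜 2 μ) :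
    ∀ᵐ x ∂μ, ∀ k : ℤ, alpertProj μ P (D.cubeAt k x) f x =
      expProj μ P (D.cubeAt (k - 1) x).toSet f x - expProj μ P (D.cubeAt k x).toSet f x := by
  have h : ∀ Q ∈ D.cubes, ∀ᵐ x ∂μ, ∀ ε, x ∈ (Q.child ε).toSet →
      alpertProj μ P Q f x = expProj μ P (Q.child ε).toSet f x - expProj μ P Q.toSet f x := by
    intro Q _
    rw [ae_all_iff]
    intro ε
    have hm := (Q.child ε).measurableSet_toSet
    have h1 := cut_coeFn hm (alpertProj μ P Q f)
    rw [cut_child_alpertProj hP] at h1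
    filter_upwards [h1, cut_coeFn hm (expProj μ P Q.toSet f),
      Lp.coeFn_sub (expProj μ P (Q.child ε).toSet f)
        (cut μ (Q.child ε).toSet (expProj μ P Q.toSet f))] with x h2 h3 h4 hx
    rw [Set.indicator_of_mem hx] at h2 h3
    rw [← h2, h4, Pi.sub_apply, h3]
  filter_upwards [ae_forall_cubeAt D h] with x hx k
  obtain ⟨ε, hε⟩ := DyadicCube.exists_mem_child (D.mem_cubeAt k x)
  have hc : D.cubeAt (k - 1) x = (D.cubeAt k x).child ε :=
    DyadicGrid.cubeAt_eq (D.child_mem _ (D.cubeAt_mem k x) ε)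
      (by rw [DyadicCube.child_scale, D.cubeAt_scale]) hε
  rw [hc]
  exact hx k ε hε

theorem ae_sum_alpertProj_cubeAt (hP : ∀ φ ∈ P, LocL2 μ φ) (D : DyadicGrid n) (f : Lp 𝕜 2 μ) :
    ∀ᵐ x ∂μ, ∀ a b : ℤ, a - 1 ≤ b →
      ∑ k ∈ Finset.Icc a b, alpertProj μ P (D.cubeAt k x) f x =
        expProj μ P (D.cubeAt (a - 1) x).toSet f x - expProj μ P (D.cubeAt b x).toSet f x := by
  filter_upwards [ae_alpertProj_cubeAt hP D f] with x hx a b hab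
  simp_rw [hx]
  exact sum_Icc_sub (fun k => expProj μ P (D.cubeAt k x).toSet f x) hab

theorem alpertProj_eq_zero {Q : DyadicCube n} {f : Lp 𝕜 2 μ}
    (h : ∀ g : Lp 𝕜 2 μ, ⟪alpertProj μ P Q g, f⟫_𝕜 = 0) : alpertProj μ P Q f = 0 := by
  refine Submodule.eq_starProjection_of_mem_orthogonal (Submodule.zero_mem _) fun v hv => ?_
  rw [sub_zero, ← h v, alpertProj, Submodule.starProjection_eq_self_iff.2 hv]

theorem inner_expProj_alpertProj (hP : ∀ φ ∈ P, LocL2 μ φ) {D : DyadicGrid n}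
    {T : Set (EuclideanSpace ℝ (Fin n))} (hT : T ∈ D.tops) {Q : DyadicCube n} (hQ : Q ∈ D.cubes)
    (f g : Lp 𝕜 2 μ) : ⟪expProj μ P T f, alpertProj μ P Q g⟫_𝕜 = 0 :=
  inner_alpertProj_eq_zero hP (DyadicGrid.measurableSet_top hT)
    (DyadicGrid.disjoint_or_subset_top hQ hT) (expProj_mem T f) g

theorem alpertProj_alpertProj_self (Q : DyadicCube n) (f : Lp 𝕜 2 μ) :
    alpertProj μ P Q (alpertProj μ P Q f) = alpertProj μ P Q f :=
  Submodule.starProjection_eq_self_iff.2 (alpertProj_mem Q f)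

theorem inner_alpertProj_self (Q : DyadicCube n) (f : Lp 𝕜 2 μ) :
    ⟪alpertProj μ P Q f, alpertProj μ P Q f⟫_𝕜 = ⟪alpertProj μ P Q f, f⟫_𝕜 := by
  have h := Submodule.sub_starProjection_mem_orthogonal (K := alpertSpace μ P Q) f _
    (alpertProj_mem Q f)
  rw [inner_sub_right, sub_eq_zero] at h
  exact h.symm

/-- A function that is annihilated by all the projections vanishes. -/
theorem eq_zero_of_forall_proj_eq_zero [IsLocallyFiniteMeasure μ] (hP : ∀ φ ∈ P, LocL2 μ φ)
    (hone : (fun _ => 1 : EuclideanSpace ℝ (Fin n) → 𝕜) ∈ P) (D : DyadicGrid n) {f : Lp 𝕜 2 μ}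
    (hQ : ∀ Q ∈ D.cubes, alpertProj μ P Q f = 0) (hT : ∀ T ∈ D.tops, expProj μ P T f = 0) :
    f = 0 := by
  apply Lp.ext
  have h1 : ∀ᵐ x ∂μ, ∀ k : ℤ, alpertProj μ P (D.cubeAt k x) f x = 0 :=
    ae_forall_cubeAt D (p := fun Q x => alpertProj μ P Q f x = 0) fun Q hQD => by
      rw [hQ Q hQD]
      exact Lp.coeFn_zero 𝕜 2 μ
  filter_upwards [h1, ae_alpertProj_cubeAt hP D f, ae_tendsto_expProj_atTop (P := P) D f,
    ae_tendsto_expProj_atBot hP hone D f, Lp.coeFn_zero 𝕜 2 μ] with x h2 h3 h4 h5 h6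
  rw [hT _ (DyadicGrid.topAt_mem_tops x), h6] at h4
  rw [h6]
  -- With all Alpert projections zero, the projections at x do not depend on the scale; their limits
  -- at the two ends are f(x) and 0.
  have h7 : ∀ k : ℤ, expProj μ P (D.cubeAt k x).toSet f x =
      expProj μ P (D.cubeAt 0 x).toSet f x := by
    intro k
    have hstep : ∀ k : ℤ, expProj μ P (D.cubeAt (k - 1) x).toSet f x =
        expProj μ P (D.cubeAt k x).toSet f x := fun k =>
      sub_eq_zero.1 ((h3 k).symm.trans (h2 k))
    induction k using Int.induction_on with
    | zero => rfl
    | succ k ih => rw [← ih, ← hstep, add_sub_cancel_right]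
    | pred k ih => rw [← ih, hstep]
  simp_rw [h7] at h4 h5
  exact (tendsto_nhds_unique h5 tendsto_const_nhds).trans
    (tendsto_nhds_unique h4 tendsto_const_nhds).symm

/-- Bessel's inequality: a finite partial sum g satisfies ‖g‖² = Re⟨g, f⟩ ≤ ‖g‖ ‖f‖, so the squared
norms are summable, which suffices for an orthogonal family. -/
theorem summable_alpertProj (hP : ∀ φ ∈ P, LocL2 μ φ) (D : DyadicGrid n) (f : Lp 𝕜 2 μ) :
    Summable fun Q : D.cubes => alpertProj μ P Q f := by
  have horth : OrthogonalFamily 𝕜 (fun Q : D.cubes => alpertSpace μ P Q.1)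
      fun Q => (alpertSpace μ P Q.1).subtypeₗᵢ := by
    intro Q R hne v w
    have h := inner_alpertProj_alpertProj hP Q.2 R.2 (fun h => hne (Subtype.ext h))
      (v : Lp 𝕜 2 μ) (w : Lp 𝕜 2 μ)
    rwa [alpertProj, alpertProj, Submodule.starProjection_eq_self_iff.2 v.2,
      Submodule.starProjection_eq_self_iff.2 w.2] at h
  let u : (Q : D.cubes) → alpertSpace μ P Q.1 := fun Q =>
    ⟨alpertProj μ P Q f, alpertProj_mem Q.1 f⟩
  refine (horth.summable_iff_norm_sq_summable u).2
    (summable_of_sum_le (c := ‖f‖ ^ 2) (fun Q => sq_nonneg _) fun s => ?_)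
  have h1 : ‖∑ Q ∈ s, alpertProj μ P Q.1 f‖ ^ 2 = ∑ Q ∈ s, ‖u Q‖ ^ 2 := horth.norm_sum u s
  have h2 : RCLike.re ⟪∑ Q ∈ s, alpertProj μ P Q.1 f, f⟫_𝕜 = ∑ Q ∈ s, ‖u Q‖ ^ 2 := by
    rw [sum_inner, map_sum]
    refine Finset.sum_congr rfl fun Q _ => ?_
    rw [← inner_alpertProj_self, inner_self_eq_norm_sq]
    rfl
  have h3 := (RCLike.re_le_norm _).trans
    (norm_inner_le_norm (𝕜 := 𝕜) (∑ Q ∈ s, alpertProj μ P Q.1 f) f)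
  rw [h2, ← h1] at h3
  rw [← h1]
  refine pow_le_pow_left₀ (norm_nonneg _) ?_ 2
  by_contra! hlt
  nlinarith [norm_nonneg f]

/-- Bessel gives some sum g. By orthogonality every projection annihilates f − ∑ E_T f − g, so this
difference vanishes. -/
theorem hasSum_alpertProj [IsLocallyFiniteMeasure μ] (hP : ∀ φ ∈ P, LocL2 μ φ)
    (hone : (fun _ => 1 : EuclideanSpace ℝ (Fin n) → 𝕜) ∈ P) (D : DyadicGrid n) (f : Lp 𝕜 2 μ) :
    HasSum (fun Q : D.cubes => alpertProj μ P Q f)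
      (f - ∑ T ∈ D.finite_tops.toFinset, expProj μ P T f) := by
  obtain ⟨g, hg⟩ := summable_alpertProj hP D f
  convert hg using 1
  rw [← sub_eq_zero]
  refine eq_zero_of_forall_proj_eq_zero hP hone D (fun Q hQ => ?_) fun T hT => ?_
  · have h1 : alpertProj μ P Q g = alpertProj μ P Q f := by
      refine (hg.mapL (alpertProj μ P Q)).unique ?_
      have h2 := hasSum_single (f := fun R : D.cubes =>
        alpertProj μ P Q (alpertProj μ P R f)) ⟨Q, hQ⟩ fun R hne =>
          alpertProj_eq_zero fun v => inner_alpertProj_alpertProj hP hQ R.2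
            (fun h => hne (Subtype.ext h.symm)) v f
      simpa only [alpertProj_alpertProj_self] using h2
    have h2 : alpertProj μ P Q (∑ T ∈ D.finite_tops.toFinset, expProj μ P T f) = 0 := by
      rw [map_sum]
      exact Finset.sum_eq_zero fun T hT => alpertProj_eq_zero fun v =>
        inner_eq_zero_symm.1 (inner_expProj_alpertProj hP (D.finite_tops.mem_toFinset.1 hT) hQ f v)
    rw [map_sub, map_sub, h1, h2, sub_zero, sub_self]
  · have hTm := DyadicGrid.measurableSet_top hT
    have h0 : ∀ {v : Lp 𝕜 2 μ}, (∀ w ∈ localSpace μ P T, ⟪w, v⟫_𝕜 = 0) →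
        expProj μ P T v = 0 := fun h =>
      expProj_eq (Submodule.zero_mem _) fun w hw => by rw [h w hw, inner_zero_right]
    have h1 : expProj μ P T g = 0 := by
      refine (hg.mapL (expProj μ P T)).unique ?_
      convert hasSum_zero with R
      exact h0 fun w hw => inner_alpertProj_eq_zero hP hTm
        (DyadicGrid.disjoint_or_subset_top R.2 hT) hw f
    have h2 : expProj μ P T (∑ T' ∈ D.finite_tops.toFinset, expProj μ P T' f) =
        expProj μ P T f := by
      rw [map_sum, Finset.sum_eq_single T]
      · exact expProj_eq (expProj_mem T f) fun _ _ => rfl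
      · intro T' hT' hne
        rw [Set.Finite.mem_toFinset] at hT'
        refine h0 fun w hw => inner_eq_zero_of_disjoint hTm (DyadicGrid.measurableSet_top hT')
          (DyadicGrid.disjoint_tops hT hT' hne.symm) (cut_eq_of_mem_localSpace hTm hw)
          (cut_expProj (DyadicGrid.measurableSet_top hT') f)
      · exact fun h => absurd (D.finite_tops.mem_toFinset.2 hT) h
    rw [map_sub, map_sub, h1, h2, sub_self, sub_zero]

/-- The telescoped sum is a function of a alone minus a function of b alone, which is why the two
limits may be taken independently; the projection onto the top of x cancels the limit in b. -/
theorem ae_tendsto_sum_alpertProj [IsLocallyFiniteMeasure μ] (hP : ∀ φ ∈ P, LocL2 μ φ)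
    (hone : (fun _ => 1 : EuclideanSpace ℝ (Fin n) → 𝕜) ∈ P) (D : DyadicGrid n) (f : Lp 𝕜 2 μ) :
    ∀ᵐ x ∂μ, Tendsto (fun ab : ℤ × ℤ =>
      (∑ T ∈ D.finite_tops.toFinset, expProj μ P T f x) +
      (∑ k ∈ Finset.Icc ab.1 ab.2, alpertProj μ P (D.cubeAt k x) f x))
      (atBot ×ˢ atTop) (𝓝 (f x)) := by
  filter_upwards [ae_sum_expProj_tops (P := P) D f, ae_sum_alpertProj_cubeAt hP D f,
    ae_tendsto_expProj_atTop (P := P) D f, ae_tendsto_expProj_atBot hP hone D f]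
    with x h1 h2 h3 h4
  have hshift : Tendsto (fun a : ℤ => a - 1) atBot atBot :=
    tendsto_atBot_mono (fun a => (Int.sub_le_self a zero_le_one : a - 1 ≤ a)) tendsto_id
  have h5 := (tendsto_const_nhds (x := expProj μ P (D.topAt x) f x)).add
    (((h4.comp hshift).comp tendsto_fst).sub (h3.comp (tendsto_snd (f := (atBot : Filter ℤ)))))
  rw [add_sub_cancel] at h5
  refine h5.congr' ?_
  filter_upwards [(eventually_le_atBot (0 : ℤ)).prod_mk (eventually_ge_atTop (0 : ℤ))]
    with ab hab
  rw [h1, h2 _ _ (by omega)]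
  rfl

theorem setOf_between_eq_image {D : DyadicGrid n} {Q R : DyadicCube n}
    (hQ : Q ∈ D.cubes) (hR : R ∈ D.cubes) (h : Q.toSet ⊂ R.toSet) :
    {I ∈ D.cubes | Q.toSet ⊂ I.toSet ∧ I.toSet ⊆ R.toSet} =
      (fun k => D.cubeAt k Q.corner) '' (Finset.Icc (Q.scale + 1) R.scale : Set ℤ) := by
  -- Strict inclusion excludes dimension 0, where inclusion of cubes says nothing about their
  -- scales.
  have hn : NeZero n := ⟨by
    rintro rfl
    refine h.2 fun x _ => ?_
    rw [Subsingleton.elim x Q.corner]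
    exact Q.corner_mem⟩
  ext I
  simp only [Set.mem_ofPred_eq, Set.mem_image, Finset.coe_Icc, Set.mem_Icc]
  constructor
  · rintro ⟨hI, h1, h2⟩
    refine ⟨I.scale, ⟨?_, DyadicCube.scale_le_of_subset h2⟩,
      DyadicGrid.cubeAt_eq hI rfl (h1.1 Q.corner_mem)⟩
    by_contra! hlt
    exact h1.2 (DyadicGrid.subset_of_mem hI hQ (by omega) (h1.1 Q.corner_mem) Q.corner_mem)
  · rintro ⟨k, ⟨h1, h2⟩, rfl⟩
    have hm := D.mem_cubeAt k Q.corner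
    refine ⟨D.cubeAt_mem _ _, ⟨DyadicGrid.subset_of_mem hQ (D.cubeAt_mem _ _)
      (by rw [D.cubeAt_scale]; omega) Q.corner_mem hm, fun hsub => ?_⟩,
      DyadicGrid.subset_of_mem (D.cubeAt_mem _ _) hR (by rwa [D.cubeAt_scale]) hm
        (h.1 Q.corner_mem)⟩
    have := DyadicCube.scale_le_of_subset hsub
    rw [D.cubeAt_scale] at this
    omega

theorem indicator_sum_alpertProj (hP : ∀ φ ∈ P, LocL2 μ φ) {D : DyadicGrid n}
    {Q R : DyadicCube n} (hQ : Q ∈ D.cubes) (hR : R ∈ D.cubes) (h : Q.toSet ⊂ R.toSet)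
    (hI : {I ∈ D.cubes | Q.toSet ⊂ I.toSet ∧ I.toSet ⊆ R.toSet}.Finite) (f : Lp 𝕜 2 μ) :
    Q.toSet.indicator (fun x => ∑ I ∈ hI.toFinset, alpertProj μ P I f x) =ᵐ[μ]
      fun x => expProj μ P Q.toSet f x -
        Q.toSet.indicator (fun y => expProj μ P R.toSet f y) x := by
  classical
  have himage : hI.toFinset =
      (Finset.Icc (Q.scale + 1) R.scale).image fun k => D.cubeAt k Q.corner := by
    rw [← Finset.coe_inj, Set.Finite.coe_toFinset, Finset.coe_image,
      setOf_between_eq_image hQ hR h]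
  have hinj : Function.Injective fun k => D.cubeAt k Q.corner := fun j k hjk => by
    simpa using congrArg DyadicCube.scale hjk
  have hle : Q.scale ≤ R.scale := by
    by_contra! hlt
    exact h.2 (DyadicGrid.subset_of_mem hR hQ hlt.le (h.1 Q.corner_mem) Q.corner_mem)
  filter_upwards [ae_sum_alpertProj_cubeAt hP D f,
    ae_expProj_eq_zero (P := P) Q.measurableSet_toSet f] with x h1 h2
  by_cases hx : x ∈ Q.toSet
  · rw [Set.indicator_of_mem hx, Set.indicator_of_mem hx, himage,
      Finset.sum_image hinj.injOn]
    have h3 := h1 (Q.scale + 1) R.scale (by omega)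
    rw [add_sub_cancel_right, DyadicGrid.cubeAt_eq hQ rfl hx,
      DyadicGrid.cubeAt_eq hR rfl (h.1 hx)] at h3
    rw [← h3]
    refine Finset.sum_congr rfl fun k hk => ?_
    rw [Finset.mem_Icc] at hk
    have hxc : x ∈ (D.cubeAt Q.scale Q.corner).toSet := by
      rwa [DyadicGrid.cubeAt_eq hQ rfl Q.corner_mem]
    rw [DyadicGrid.cubeAt_eq_cubeAt (by omega : Q.scale ≤ k) hxc]
  · rw [Set.indicator_of_notMem hx, Set.indicator_of_notMem hx, h2 hx, sub_zero]

end Main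
end AlpertBasis

theorem mainTheorem2 {𝕜 : Type*} [RCLike 𝕜] {n : ℕ}
    (μ : Measure (EuclideanSpace ℝ (Fin n))) [IsLocallyFiniteMeasure μ]
    (P : Submodule 𝕜 (EuclideanSpace ℝ (Fin n) → 𝕜)) [FiniteDimensional 𝕜 P]
    (hP : ∀ φ ∈ P, AlpertBasis.LocL2 μ φ)
    (hone : (fun _ => 1 : EuclideanSpace ℝ (Fin n) → 𝕜) ∈ P)
    (D : AlpertBasis.DyadicGrid n) :
    -- finitely many tops; mutual orthogonality; completeness in `L²(μ)` and almost everywhere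
    (∃ hfin : D.tops.Finite,
      (1 ≤ hfin.toFinset.card ∧ hfin.toFinset.card ≤ 2 ^ n) ∧
      (∀ T ∈ D.tops, ∀ T' ∈ D.tops, T ≠ T' → ∀ f g : Lp 𝕜 2 μ,
        ⟪AlpertBasis.expProj μ P T f, AlpertBasis.expProj μ P T' g⟫_𝕜 = 0) ∧
      (∀ T ∈ D.tops, ∀ Q ∈ D.cubes, ∀ f g : Lp 𝕜 2 μ,
        ⟪AlpertBasis.expProj μ P T f, AlpertBasis.alpertProj μ P Q g⟫_𝕜 = 0) ∧
      (∀ Q ∈ D.cubes, ∀ R ∈ D.cubes, Q ≠ R → ∀ f g : Lp 𝕜 2 μ,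
        ⟪AlpertBasis.alpertProj μ P Q f, AlpertBasis.alpertProj μ P R g⟫_𝕜 = 0) ∧
      ∀ f : Lp 𝕜 2 μ,
        HasSum (fun Q : D.cubes => AlpertBasis.alpertProj μ P Q f)
          (f - ∑ T ∈ hfin.toFinset, AlpertBasis.expProj μ P T f) ∧
        ∀ᵐ x ∂μ,
          (∀ Q ∈ D.cubes, x ∉ Q.toSet → AlpertBasis.alpertProj μ P Q f x = 0) ∧
          Tendsto (fun ab : ℤ × ℤ =>
              (∑ T ∈ hfin.toFinset, AlpertBasis.expProj μ P T f x) +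
              (∑ k ∈ Finset.Icc ab.1 ab.2, AlpertBasis.alpertProj μ P (D.cubeAt k x) f x))
            (atBot ×ˢ atTop) (𝓝 (f x))) ∧
    -- telescoping
    (∀ Q ∈ D.cubes, ∀ R ∈ D.cubes, Q.toSet ⊂ R.toSet →
      ∃ hI : {I ∈ D.cubes | Q.toSet ⊂ I.toSet ∧ I.toSet ⊆ R.toSet}.Finite,
        ∀ f : Lp 𝕜 2 μ,
          Q.toSet.indicator (fun x => ∑ I ∈ hI.toFinset, AlpertBasis.alpertProj μ P I f x) =ᵐ[μ]
            fun x => AlpertBasis.expProj μ P Q.toSet f x -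
              Q.toSet.indicator (fun y => AlpertBasis.expProj μ P R.toSet f y) x) ∧
    -- vanishing moments
    (∀ Q ∈ D.cubes, ∀ φ ∈ P, ∀ f : Lp 𝕜 2 μ,
      Integrable (fun x => AlpertBasis.alpertProj μ P Q f x * conj (φ x)) μ ∧
        ∫ x, AlpertBasis.alpertProj μ P Q f x * conj (φ x) ∂μ = 0) := by
  refine ⟨⟨D.finite_tops, ⟨?_, ?_⟩, ?_, ?_, ?_, fun f => ⟨?_, ?_⟩⟩, ?_, ?_⟩
  · exact Finset.card_pos.2 ⟨D.topAt 0,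
      D.finite_tops.mem_toFinset.2 (AlpertBasis.DyadicGrid.topAt_mem_tops 0)⟩
  · exact AlpertBasis.DyadicGrid.card_tops_le _ (by rw [Set.Finite.coe_toFinset])
  · intro T hT T' hT' hne f g
    exact AlpertBasis.inner_expProj_expProj_of_disjoint
      (AlpertBasis.DyadicGrid.measurableSet_top hT) (AlpertBasis.DyadicGrid.measurableSet_top hT')
      (AlpertBasis.DyadicGrid.disjoint_tops hT hT' hne) f g
  · intro T hT Q hQ f g
    exact AlpertBasis.inner_expProj_alpertProj hP hT hQ f g
  · intro Q hQ R hR hne f g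
    exact AlpertBasis.inner_alpertProj_alpertProj hP hQ hR hne f g
  · exact AlpertBasis.hasSum_alpertProj hP hone D f
  · filter_upwards [AlpertBasis.ae_alpertProj_eq_zero hP D f,
      AlpertBasis.ae_tendsto_sum_alpertProj hP hone D f] with x h1 h2 using ⟨h1, h2⟩
  · intro Q hQ R hR h
    have hI : {I ∈ D.cubes | Q.toSet ⊂ I.toSet ∧ I.toSet ⊆ R.toSet}.Finite := by
      rw [AlpertBasis.setOf_between_eq_image hQ hR h]
      exact (Finset.finite_toSet _).image _
    exact ⟨hI, fun f => AlpertBasis.indicator_sum_alpertProj hP hQ hR h hI f⟩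
  · intro Q _ φ hφ f
    exact AlpertBasis.integrable_alpertProj_mul_conj hP Q hφ f
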